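/- Let $(X,\langle\cdot,\cdot\rangle,\|\cdot\|)$ be a separable real Hilbert space and let $A:D(A)\subset X\to X$ be a densely defined linear operator such that: (a) $A$ is self-adjoint; (b) $\langle Ax,x\rangle\ge 0$ for all $x\in D(A)$; (c) there is $\lambda>0$ such that $(\lambda I+A)^{-1}:X\to X$ is compact. Then $X$ has an orthonormal basis $(\varphi_k)_{k\ge1}$ with $\varphi_k\in D(A)$, $A\varphi_k=\lambda_k\varphi_k$, $0\le\lambda_1\le\lambda_2\le\dots$. Put $$e^{-tA}x=\sum_k e^{-\lambda_k t}\langle x,\varphi_k\rangle\varphi_k,\qquad D(A^{1/2})=\Big\{x\in X:\sum_k\lambda_k|\langle x,\varphi_k\rangle|^2<\infty\Big\},\qquad A^{1/2}x=\sum_k\lambda_k^{1/2}\langle x,\varphi_k\rangle\varphi_k,$$ $\langle x,y\rangle_{1/2}=\langle x,y\rangle+\langle A^{1/2}x,A^{1/2}y\rangle$ and $\|x\|_{1/2}=(\|x\|^2+\|A^{1/2}x\|^2)^{1/2}$ for $x,y\in D(A^{1/2})$, and let $\psi_1(t)=e^{-\lambda_1t}\varphi_1$ be the ground state solution. Let $B:D(B)\subset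 X\to X$ be a linear operator with $D(A^{1/2})\subset D(B)$ for which there is $C_B>0$ such that $\|B\varphi\|\le C_B\|\varphi\|_{1/2}$ for all $\varphi\in D(A^{1/2})$. For $y_0\in X$ and $p\in L^2(0,T)$ (real-valued) let $$y(t;y_0,p)=e^{-tA}y_0-\int_0^te^{-(t-s)A}p(s)B\varphi_1\,ds$$ be the mild solution of $y'+Ay+p(t)B\varphi_1=0$, $y(0)=y_0$. Assume that $\{A,B\}$ is $1$-null controllable in every time $T>0$: there is $N_T>0$ such that for every $y_0\in X$ there is $p\in L^2(0,T)$ with $\|p\|_{L^2(0,T)}\le N_T\|y_0\|$ and $y(T;y_0,p)=0$. Assume moreover that the control cost $$N(T)=\sup_{\|y_0\|=1}\inf\{\|p\|_{L^2(0,T)}:\ y(T;y_0,p)=0\}$$ satisfies, for some $\nu,T_0>0$, $N(\tau)\le e^{\nu/\tau}$ for all $0<\tau\le T_0$. Then for every $R>0$ there exists $T_R>0$ such that for every $u_0\in D(A^{1/2})$ satisfying $$\|u_0-\langle u_0,\varphi_1\rangle_{1/2}\,\varphi_1\|_{1/2}\le R\,|\langle u_0,\varphi_1\rangle_{1/2}|$$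 the system $u'(t)+Au(t)+p(t)Bu(t)=0$, $u(0)=u_0$, is exactly controllable in time $T_R$ to $\phi_1(t)=\langle u_0,\varphi_1\rangle_{1/2}\,\psi_1(t)$: there is a control $p\in L^2(0,T_R)$ whose mild solution $u\in C([0,T_R];D(A^{1/2}))$, that is, $$u(t)=e^{-tA}u_0-\int_0^te^{-(t-s)A}p(s)Bu(s)\,ds,\qquad t\in[0,T_R],$$ satisfies $u(T_R)=\phi_1(T_R)$. -/

import Mathlib

open MeasureTheory Set
open scoped ENNReal

noncomputable section

namespace BilinearControl

variable {X : Type*} [NormedAddCommGroup X] [InnerProductSpace ℝ X] [CompleteSpace X]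

/-! ### Operators with compact resolvent -/

/-- For some `c > 0` the operator `c I + A : D(A) → X` has a two-sided inverse that is defined and
compact on the whole of `X`. -/
def HasCompactResolvent (A : X →ₗ.[ℝ] X) : Prop :=
  ∃ c : ℝ, 0 < c ∧ ∃ K : X →L[ℝ] X, IsCompactOperator K ∧
    (∀ x : X, ∃ h : K x ∈ A.domain, c • K x + A ⟨K x, h⟩ = x) ∧
    ∀ x : A.domain, K (c • (x : X) + A x) = x

/-- The standing assumptions on `A`: densely defined, self-adjoint, nonnegative, with compact
resolvent. -/
structure IsAdmissible (A : X →ₗ.[ℝ] X) : Prop where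
  dense : Dense (A.domain : Set X)
  selfAdjoint : IsSelfAdjoint A
  nonneg : ∀ x : A.domain, 0 ≤ inner ℝ (A x) (x : X)
  compactResolvent : HasCompactResolvent A

/-- The eigenspace `ker (A - μ I)`, a subspace of `X`. -/
def eigenspace (A : X →ₗ.[ℝ] X) (μ : ℝ) : Submodule ℝ X where
  carrier := {x | ∃ h : x ∈ A.domain, A ⟨x, h⟩ = μ • x}
  zero_mem' := ⟨A.domain.zero_mem, by
    rw [smul_zero]; exact A.map_zero⟩
  add_mem' := by
    rintro x y ⟨hx, ex⟩ ⟨hy, ey⟩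
    refine ⟨A.domain.add_mem hx hy, ?_⟩
    rw [smul_add, ← ex, ← ey]
    exact A.map_add ⟨x, hx⟩ ⟨y, hy⟩
  smul_mem' := by
    rintro c x ⟨hx, ex⟩
    refine ⟨A.domain.smul_mem c hx, ?_⟩
    rw [smul_comm, ← ex]
    exact A.map_smul c ⟨x, hx⟩

/-- The orthogonal projection of `X` onto the eigenspace `ker (A - μ I)`; it is `0` if `μ` is not an
eigenvalue. For a self-adjoint `A` the eigenspace is closed, and the closure changes nothing. -/
def eigenproj (A : X →ₗ.[ℝ] X) (μ : ℝ) : X →L[ℝ] X :=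
  (eigenspace A μ).topologicalClosure.starProjection

/-- `φ₁` is a normalized eigenvector of `A` for the smallest eigenvalue `lam₁`. -/
def IsGroundState (A : X →ₗ.[ℝ] X) (lam₁ : ℝ) (φ₁ : X) : Prop :=
  ‖φ₁‖ = 1 ∧ φ₁ ∈ eigenspace A lam₁ ∧ ∀ μ : ℝ, eigenspace A μ ≠ ⊥ → lam₁ ≤ μ

/-- The ground state solution `ψ₁(t) = exp (-λ₁ t) φ₁`. -/
def groundStateSolution (lam₁ : ℝ) (φ₁ : X) (t : ℝ) : X :=
  Real.exp (-lam₁ * t) • φ₁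

/-! ### Semigroup and fractional powers

For an operator with compact resolvent as above, `X` is the Hilbert sum of the eigenspaces, so that
functions of `A` are given by their eigenvector expansion. In an orthonormal basis `(φ_k)` of
eigenvectors, `A φ_k = λ_k φ_k`, the term with index `μ` of the sums below collects the terms
`⟨x, φ_k⟩ φ_k` with `λ_k = μ`. -/

/-- The semigroup `e^{-tA} x = ∑_k e^{-λ_k t} ⟨x, φ_k⟩ φ_k`. -/
def semigroup (A : X →ₗ.[ℝ] X) (t : ℝ) (x : X) : X :=
  ∑' μ : ℝ, Real.exp (-μ * t) • eigenproj A μ x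

/-- The domain `D(A^s)`: all `x` with `∑_k λ_k^{2s} |⟨x, φ_k⟩|² < ∞`. -/
def powDomain (A : X →ₗ.[ℝ] X) (s : ℝ) : Set X :=
  {x | Summable fun μ : ℝ => μ ^ (2 * s) * ‖eigenproj A μ x‖ ^ 2}

/-- The fractional power `A^s x = ∑_k λ_k^s ⟨x, φ_k⟩ φ_k`. -/
def fracPow (A : X →ₗ.[ℝ] X) (s : ℝ) (x : X) : X :=
  ∑' μ : ℝ, μ ^ s • eigenproj A μ x

/-- The scalar product `⟨x, y⟩_s = ⟨x, y⟩ + ⟨A^s x, A^s y⟩` of `D(A^s)`. -/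
def powInner (A : X →ₗ.[ℝ] X) (s : ℝ) (x y : X) : ℝ :=
  inner ℝ x y + inner ℝ (fracPow A s x) (fracPow A s y)

/-- The norm `‖x‖_s = (‖x‖² + ‖A^s x‖²)^{1/2}` of `D(A^s)`. -/
def powNorm (A : X →ₗ.[ℝ] X) (s : ℝ) (x : X) : ℝ :=
  Real.sqrt (‖x‖ ^ 2 + ‖fracPow A s x‖ ^ 2)

/-! ### The control operator and the control problems -/

/-- The continuous embedding of `D(A^{1/2})` in `D(B)`: `D(A^{1/2}) ⊆ D(B)` and
`‖B x‖ ≤ C ‖x‖_{1/2}` on `D(A^{1/2})`. -/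
def IsDominated (A B : X →ₗ.[ℝ] X) : Prop :=
  ∃ C : ℝ, 0 < C ∧ ∀ x ∈ powDomain A (1 / 2),
    ∃ h : x ∈ B.domain, ‖B ⟨x, h⟩‖ ≤ C * powNorm A (1 / 2) x

open Classical in
/-- `B x` for `x ∈ D(B)`, extended by `0` to all of `X`. It is only used on `D(B)`. -/
def applyExt (B : X →ₗ.[ℝ] X) (x : X) : X :=
  if h : x ∈ B.domain then B ⟨x, h⟩ else 0

/-- `p ∈ L²(0,T)`. -/
def IsControl (T : ℝ) (p : ℝ → ℝ) : Prop :=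
  MemLp p 2 (volume.restrict (Ioc 0 T))

/-- `‖p‖_{L²(0,T)}`. -/
def controlNorm (T : ℝ) (p : ℝ → ℝ) : ℝ≥0∞ :=
  eLpNorm p 2 (volume.restrict (Ioc 0 T))

/-- The mild solution `y(t; y₀, p)` of the linear problem `y' + A y + p(t) B φ₁ = 0`,
`y(0) = y₀`. -/
def linearSolution (A B : X →ₗ.[ℝ] X) (φ₁ y₀ : X) (p : ℝ → ℝ) (t : ℝ) : X :=
  semigroup A t y₀ - ∫ s in (0 : ℝ)..t, semigroup A (t - s) (p s • applyExt B φ₁)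

/-- `u ∈ C([0,T]; D(A^{1/2}))` is the mild solution of the bilinear problem
`u' + A u + p(t) B u = 0`, `u(0) = u₀`, on `[0,T]`. -/
def IsSolution (A B : X →ₗ.[ℝ] X) (T : ℝ) (u₀ : X) (p : ℝ → ℝ) (u : ℝ → X) : Prop :=
  (∀ t ∈ Icc 0 T, u t ∈ powDomain A (1 / 2)) ∧
  ContinuousOn u (Icc 0 T) ∧
  ContinuousOn (fun t => fracPow A (1 / 2) (u t)) (Icc 0 T) ∧
  ∀ t ∈ Icc 0 T, u t =
    semigroup A t u₀ - ∫ s in (0 : ℝ)..t, semigroup A (t - s) (p s • applyExt B (u s))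

/-- The pair `{A, B}` is `1`-null controllable in time `T`. -/
def IsNullControllable (A B : X →ₗ.[ℝ] X) (φ₁ : X) (T : ℝ) : Prop :=
  ∃ N : ℝ, 0 < N ∧ ∀ y₀ : X, ∃ p : ℝ → ℝ, IsControl T p ∧
    controlNorm T p ≤ ENNReal.ofReal (N * ‖y₀‖) ∧ linearSolution A B φ₁ y₀ p T = 0

/-- The control cost `N(T) = sup_{‖y₀‖ = 1} inf {‖p‖_{L²(0,T)} : y(T; y₀, p) = 0}`, in `[0,∞]`. -/
def controlCost (A B : X →ₗ.[ℝ] X) (φ₁ : X) (T : ℝ) : ℝ≥0∞ :=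
  ⨆ (y₀ : X) (_ : ‖y₀‖ = 1), ⨅ (p : ℝ → ℝ) (_ : IsControl T p)
    (_ : linearSolution A B φ₁ y₀ p T = 0), controlNorm T p

/-- The bilinear problem with initial datum `u₀` is exactly controllable to the trajectory `ζ` in
time `T`: some control `p ∈ L²(0,T)` steers the solution to `u(T; u₀, p) = ζ(T)`. -/
def IsExactlyControllable (A B : X →ₗ.[ℝ] X) (T : ℝ) (u₀ : X) (ζ : ℝ → X) : Prop :=
  ∃ p : ℝ → ℝ, IsControl T p ∧ ∃ u : ℝ → X, IsSolution A B T u₀ p u ∧ u T = ζ T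

end BilinearControl

end

open BilinearControl

/-! Put `h = (1 + A)^{1/2} u`. This turns the norm of `D(A^{1/2})` into that of `X` and replaces `B`
by the bounded operator `G = B (1 + A)^{-1/2}`. What remains unbounded is `(1 + A)^{1/2}` in front
of the Duhamel integral, and L² maximal regularity absorbs it: on each spectral component,
Cauchy–Schwarz gives `‖duhamel P f t‖² ≤ 4 ∫ ‖f‖²` for `t ≤ 3` (`norm_sq_duhamel_le`). Hence the
bilinear equation is a contraction for controls of small L² norm.

Local part. Let `e` correspond to `φ₁`. A null control for the system linearized along the ground
state, applied to the bilinear system for a time `τ`, reduces a relative deviation `ε` to order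
`(e^{ν/τ} ε)²` (`exists_control_step`). This is a Newton scheme with deteriorating constants. With
`τ_n` proportional to `(2/3)^n` the total time is finite and the cost exponents grow like `(3/2)^n`;
since `3/2 < 2`, quadratic convergence wins (`exists_iteration_parameters`). The deviations tend to
zero and the glued control reaches the trajectory exactly (`exists_local_controllability`).
Linearity in the state makes the admissible deviation proportional to the size `r` of the target.

Global part. The number `⟨u₀, φ₁⟩_{1/2}` equals `(1 + λ₁)⟨u₀, φ₁⟩`, so the free evolution does not
approach the target trajectory but the one smaller by the factor `1 + λ₁`. Free evolution, with the
spectral gap, enters the local neighbourhood of that smaller trajectory; a local step lands on it;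
finitely many further local steps multiply the amplitude by `ρ` with `ρ^m = 1 + λ₁`
(`canSteer_chain`). The gap argument needs a simple ground state, and null controllability by one
scalar control forces this (`exists_proj_eq_smul`). -/

namespace BilinearControl

/-! ### Spectral calculus for an orthogonal resolution of the identity -/

/-- A family of mutually orthogonal projections, indexed by the reals and vanishing at negative
indices, that resolves the identity. -/
structure SpectralResolution {X : Type*} [NormedAddCommGroup X] [InnerProductSpace ℝ X]
    (P : ℝ → X →L[ℝ] X) : Prop where
  symm : ∀ μ x y, inner ℝ (P μ x) y = inner ℝ x (P μ y)
  idem : ∀ μ x, P μ (P μ x) = P μ x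
  ortho : ∀ μ ν x, μ ≠ ν → P μ (P ν x) = 0
  neg : ∀ μ x, μ < 0 → P μ x = 0
  hasSum : ∀ x, HasSum (fun μ => P μ x) x

/-- The function `m` of the operator resolved by `P`. -/
noncomputable def spectralMul {X : Type*} [NormedAddCommGroup X] [InnerProductSpace ℝ X]
    (P : ℝ → X →L[ℝ] X) (m : ℝ → ℝ) (x : X) : X := ∑' μ : ℝ, m μ • P μ x

namespace SpectralResolution

variable {X : Type*} [NormedAddCommGroup X] [InnerProductSpace ℝ X] {P : ℝ → X →L[ℝ] X}

theorem inner_eq_zero (hP : SpectralResolution P) {μ ν : ℝ} (h : μ ≠ ν) (x y : X) :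
    inner ℝ (P μ x) (P ν y) = 0 := by
  rw [hP.symm, hP.ortho μ ν y h, inner_zero_right]

theorem inner_self (hP : SpectralResolution P) (μ : ℝ) (x : X) :
    inner ℝ (P μ x) x = ‖P μ x‖ ^ 2 := by
  rw [← real_inner_self_eq_norm_sq, hP.symm μ x (P μ x), hP.idem, ← hP.symm]

theorem norm_le (hP : SpectralResolution P) (μ : ℝ) (x : X) : ‖P μ x‖ ≤ ‖x‖ := by
  have h1 := real_inner_le_norm (P μ x) x
  rw [hP.inner_self] at h1
  by_contra! h
  nlinarith [norm_nonneg x]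

theorem hasSum_norm_sq (hP : SpectralResolution P) (x : X) :
    HasSum (fun μ => ‖P μ x‖ ^ 2) (‖x‖ ^ 2) := by
  have h := (innerSL ℝ x).hasSum (hP.hasSum x)
  simp only [innerSL_apply_apply, real_inner_self_eq_norm_sq] at h
  refine h.congr_fun fun μ => ?_
  rw [← hP.inner_self, real_inner_comm]

theorem summable_norm_sq (hP : SpectralResolution P) (x : X) :
    Summable (fun μ => ‖P μ x‖ ^ 2) := (hP.hasSum_norm_sq x).summable

/-- The main device of the file: identities between vectors are checked on spectral components,
where functions of `A` are scalars. -/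
theorem ext (hP : SpectralResolution P) {x y : X} (h : ∀ μ, P μ x = P μ y) : x = y :=
  (hP.hasSum x).unique ((hP.hasSum y).congr_fun h)

theorem orthogonalFamily (hP : SpectralResolution P) :
    OrthogonalFamily ℝ (fun μ => LinearMap.range (P μ).toLinearMap)
      (fun μ => (LinearMap.range (P μ).toLinearMap).subtypeₗᵢ) := by
  rintro μ ν h ⟨_, x, rfl⟩ ⟨_, y, rfl⟩
  exact hP.inner_eq_zero h x y

theorem proj_eq_zero_of_ne (hP : SpectralResolution P) {a : ℝ → X} (ha : ∀ μ, P μ (a μ) = a μ)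
    {μ ν : ℝ} (h : ν ≠ μ) : P μ (a ν) = 0 := by
  rw [← ha ν, hP.ortho _ _ _ h.symm]

theorem proj_smul_idem (hP : SpectralResolution P) (m : ℝ → ℝ) (x : X) (μ : ℝ) :
    P μ (m μ • P μ x) = m μ • P μ x := by rw [map_smul, hP.idem]

theorem summable_spectralMul (hP : SpectralResolution P) {m : ℝ → ℝ} {C : ℝ}
    (hm : ∀ μ, 0 ≤ μ → |m μ| ≤ C) (x : X) : Summable fun μ => m μ ^ 2 * ‖P μ x‖ ^ 2 := by
  refine Summable.of_nonneg_of_le (fun μ => by positivity) (fun μ => ?_)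
    ((hP.summable_norm_sq x).mul_left (C ^ 2))
  rcases lt_or_ge μ 0 with h | h
  · simp [hP.neg μ x h]
  · exact mul_le_mul_of_nonneg_right
      (sq_le_sq.2 ((hm μ h).trans (le_abs_self C))) (sq_nonneg _)

theorem norm_le_of_proj_le (hP : SpectralResolution P) {x y : X} {C : ℝ} (hC : 0 ≤ C)
    (h : ∀ μ, ‖P μ y‖ ≤ C * ‖P μ x‖) : ‖y‖ ≤ C * ‖x‖ := by
  refine le_of_sq_le_sq ?_ (by positivity)
  rw [← (hP.hasSum_norm_sq y).tsum_eq, mul_pow, ← (hP.hasSum_norm_sq x).tsum_eq, ← tsum_mul_left]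
  refine Summable.tsum_le_tsum (fun μ => ?_) (hP.summable_norm_sq _)
    ((hP.summable_norm_sq x).mul_left _)
  rw [← mul_pow]
  exact pow_le_pow_left₀ (norm_nonneg _) (h μ) 2

variable [CompleteSpace X]

theorem summable_of_sq (hP : SpectralResolution P) {a : ℝ → X} (ha : ∀ μ, P μ (a μ) = a μ)
    (hs : Summable fun μ => ‖a μ‖ ^ 2) : Summable a :=
  (hP.orthogonalFamily.summable_iff_norm_sq_summable (fun μ => ⟨a μ, a μ, ha μ⟩)).2 hs

theorem proj_tsum (hP : SpectralResolution P) {a : ℝ → X} (ha : ∀ μ, P μ (a μ) = a μ)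
    (hs : Summable fun μ => ‖a μ‖ ^ 2) (μ : ℝ) : P μ (∑' ν, a ν) = a μ := by
  rw [(P μ).map_tsum (hP.summable_of_sq ha hs),
    tsum_eq_single μ fun ν h => hP.proj_eq_zero_of_ne ha h, ha]

theorem norm_sq_tsum (hP : SpectralResolution P) {a : ℝ → X} (ha : ∀ μ, P μ (a μ) = a μ)
    (hs : Summable fun μ => ‖a μ‖ ^ 2) : ‖∑' ν, a ν‖ ^ 2 = ∑' ν, ‖a ν‖ ^ 2 := by
  rw [← (hP.hasSum_norm_sq _).tsum_eq]
  simp only [hP.proj_tsum ha hs]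

/-- A uniformly dominated orthogonal series of continuous functions is continuous. -/
theorem continuousOn_tsum (hP : SpectralResolution P) {a : ℝ → ℝ → X} {S : Set ℝ} {g : ℝ → ℝ}
    (ha : ∀ t ∈ S, ∀ μ, P μ (a t μ) = a t μ) (hc : ∀ μ, ContinuousOn (fun t => a t μ) S)
    (hg : Summable g) (hag : ∀ t ∈ S, ∀ μ, ‖a t μ‖ ^ 2 ≤ g μ) :
    ContinuousOn (fun t => ∑' μ, a t μ) S := by
  have hs : ∀ t ∈ S, Summable fun μ => ‖a t μ‖ ^ 2 := fun t ht =>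
    Summable.of_nonneg_of_le (fun μ => sq_nonneg _) (hag t ht) hg
  refine TendstoUniformlyOn.continuousOn (F := fun (s : Finset ℝ) t => ∑ μ ∈ s, a t μ)
    (p := Filter.atTop) ?_ (Filter.Frequently.of_forall fun s =>
      continuousOn_finsetSum _ fun μ _ => hc μ)
  rw [Metric.tendstoUniformlyOn_iff]
  intro ε hε
  have h0 := tendsto_tsum_compl_atTop_zero g
  filter_upwards [h0.eventually (gt_mem_nhds (show (0 : ℝ) < ε ^ 2 by positivity))] with s hsε t ht
  -- By orthogonality the squared norm of a tail is the sum of the squared norms of its terms, so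
  -- the tails of `g` control it uniformly in `t`.
  have h1 : ‖∑' μ, a t μ - ∑ μ ∈ s, a t μ‖ ^ 2 ≤ ∑' μ : {x // x ∉ s}, g μ := by
    rw [← (hP.hasSum_norm_sq _).tsum_eq]
    have h2 : ∀ μ, P μ (∑' μ, a t μ - ∑ μ ∈ s, a t μ) = if μ ∈ s then 0 else a t μ := by
      intro μ
      rw [map_sub, hP.proj_tsum (ha t ht) (hs t ht), map_sum]
      split_ifs with h
      · rw [Finset.sum_eq_single_of_mem μ h fun ν _ h => hP.proj_eq_zero_of_ne (ha t ht) h,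
          ha t ht, sub_self]
      · rw [Finset.sum_eq_zero, sub_zero]
        intro ν hν
        exact hP.proj_eq_zero_of_ne (ha t ht) (fun h' => h (h' ▸ hν))
    have h3 : ∑' μ : {x // x ∉ s}, g μ = ∑' μ, (↑s : Set ℝ)ᶜ.indicator g μ := by
      rw [← tsum_subtype]; rfl
    rw [h3]
    refine Summable.tsum_le_tsum (fun μ => ?_) (hP.summable_norm_sq _) (hg.indicator _)
    rw [h2]
    by_cases h : μ ∈ s
    · simp [h]
    · simpa [h] using hag t ht μ
  rw [dist_eq_norm]
  exact lt_of_pow_lt_pow_left₀ 2 hε.le (h1.trans_lt hsε)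

theorem proj_spectralMul_of_summable (hP : SpectralResolution P) {m : ℝ → ℝ} {x : X}
    (h : Summable fun μ => m μ ^ 2 * ‖P μ x‖ ^ 2) (μ : ℝ) :
    P μ (spectralMul P m x) = m μ • P μ x :=
  hP.proj_tsum (hP.proj_smul_idem m x) (by simpa [norm_smul, mul_pow] using h) μ

theorem proj_spectralMul (hP : SpectralResolution P) {m : ℝ → ℝ} {C : ℝ}
    (hm : ∀ μ, 0 ≤ μ → |m μ| ≤ C) (x : X) (μ : ℝ) :
    P μ (spectralMul P m x) = m μ • P μ x :=
  hP.proj_spectralMul_of_summable (hP.summable_spectralMul hm x) μ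

theorem norm_spectralMul_le (hP : SpectralResolution P) {m : ℝ → ℝ} {C : ℝ}
    (hm : ∀ μ, 0 ≤ μ → |m μ| ≤ C) (x : X) : ‖spectralMul P m x‖ ≤ C * ‖x‖ := by
  refine hP.norm_le_of_proj_le ((abs_nonneg _).trans (hm 0 le_rfl)) fun μ => ?_
  rw [hP.proj_spectralMul hm, norm_smul]
  rcases lt_or_ge μ 0 with h | h
  · simp [hP.neg μ x h]
  · exact mul_le_mul_of_nonneg_right (hm μ h) (norm_nonneg _)

/-- A bounded function of the operator, as a continuous linear map. -/
noncomputable def mulCLM (hP : SpectralResolution P) (m : ℝ → ℝ) (C : ℝ)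
    (hm : ∀ μ, 0 ≤ μ → |m μ| ≤ C) : X →L[ℝ] X :=
  LinearMap.mkContinuous
    { toFun := spectralMul P m
      map_add' := fun x y => hP.ext fun μ => by
        simp only [map_add, hP.proj_spectralMul hm, smul_add]
      map_smul' := fun c x => hP.ext fun μ => by
        simp only [map_smul, hP.proj_spectralMul hm, RingHom.id_apply]
        rw [smul_comm] }
    C (hP.norm_spectralMul_le hm)

theorem mulCLM_apply (hP : SpectralResolution P) (m : ℝ → ℝ) (C : ℝ)
    (hm : ∀ μ, 0 ≤ μ → |m μ| ≤ C) (x : X) : hP.mulCLM m C hm x = spectralMul P m x := rfl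

end SpectralResolution

/-! ### Scalar estimates for the Duhamel kernel -/

theorem integral_mul_sq_le {α : Type*} [MeasurableSpace α] {ν : Measure α} {k g : α → ℝ}
    (hk : MemLp k 2 ν) (hg : MemLp g 2 ν) (hk0 : ∀ x, 0 ≤ k x) (hg0 : ∀ x, 0 ≤ g x) :
    (∫ x, k x * g x ∂ν) ^ 2 ≤ (∫ x, k x ^ 2 ∂ν) * ∫ x, g x ^ 2 ∂ν := by
  have h := integral_mul_le_Lp_mul_Lq_of_nonneg (μ := ν) Real.HolderConjugate.two_two
    (Filter.Eventually.of_forall hk0) (Filter.Eventually.of_forall hg0)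
    (by simpa using hk) (by simpa using hg)
  simp only [Real.rpow_two, ← Real.sqrt_eq_rpow] at h
  rw [← Real.sqrt_mul (integral_nonneg fun x => sq_nonneg _)] at h
  have h2 : (0 : ℝ) ≤ (∫ x, k x ^ 2 ∂ν) * ∫ x, g x ^ 2 ∂ν :=
    mul_nonneg (integral_nonneg fun x => sq_nonneg _) (integral_nonneg fun x => sq_nonneg _)
  calc _ ≤ (√((∫ x, k x ^ 2 ∂ν) * ∫ x, g x ^ 2 ∂ν)) ^ 2 :=
        pow_le_pow_left₀ (integral_nonneg fun x => mul_nonneg (hk0 x) (hg0 x)) h 2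
    _ = _ := Real.sq_sqrt h2

/-- The integral is at most `t ≤ 3`, and `μ` times it is `(1 - e^{-2μt})/2 ≤ 1/2`. The horizon 3 is
what the local iteration needs: `∑ (2/3)^n = 3`. -/
theorem one_add_mul_integral_exp_le {μ t : ℝ} (hμ : 0 ≤ μ) (ht : 0 ≤ t) (ht3 : t ≤ 3) :
    (1 + μ) * ∫ s in (0 : ℝ)..t, Real.exp (-μ * (t - s)) ^ 2 ≤ 4 := by
  have hc : Continuous fun s : ℝ => Real.exp (-μ * (t - s)) ^ 2 := by fun_prop
  have h1 : ∫ s in (0 : ℝ)..t, Real.exp (-μ * (t - s)) ^ 2 ≤ t := by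
    calc _ ≤ ∫ s in (0 : ℝ)..t, (1 : ℝ) := by
          refine intervalIntegral.integral_mono_on ht (hc.intervalIntegrable _ _)
            (continuous_const.intervalIntegrable _ _) fun s hs => ?_
          refine pow_le_one₀ (Real.exp_nonneg _) (Real.exp_le_one_iff.2 ?_)
          nlinarith [hs.2]
      _ = t := by simp
  have h2 : ∫ s in (0 : ℝ)..t, 2 * μ * Real.exp (-μ * (t - s)) ^ 2
      = 1 - Real.exp (-μ * t) ^ 2 := by
    have hd : ∀ s ∈ uIcc 0 t, HasDerivAt (fun s : ℝ => Real.exp (-μ * (t - s)) ^ 2)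
        (2 * μ * Real.exp (-μ * (t - s)) ^ 2) s := by
      intro s _
      have h := (((hasDerivAt_id s).const_sub t).const_mul (-μ)).exp.pow 2
      refine h.congr_deriv ?_
      simp only [id]; ring
    rw [intervalIntegral.integral_eq_sub_of_hasDerivAt hd
      ((continuous_const.mul hc).intervalIntegrable _ _)]
    simp
  rw [intervalIntegral.integral_const_mul] at h2
  nlinarith [sq_nonneg (Real.exp (-μ * t))]

/-! ### Maximal regularity of the Duhamel integral -/

section Duhamel

variable {X : Type*} [NormedAddCommGroup X] [InnerProductSpace ℝ X]

/-- The component at `μ` of `(1 + A)^{1/2} ∫₀ᵗ e^{-(t-s)A} f(s) ds`. -/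
noncomputable def duhamelTerm (P : ℝ → X →L[ℝ] X) (f : ℝ → X) (t μ : ℝ) : X :=
  √(1 + μ) • ∫ s in (0 : ℝ)..t, Real.exp (-μ * (t - s)) • P μ (f s)

/-- `(1 + A)^{1/2} ∫₀ᵗ e^{-(t-s)A} f(s) ds`. -/
noncomputable def duhamel (P : ℝ → X →L[ℝ] X) (f : ℝ → X) (t : ℝ) : X :=
  ∑' μ, duhamelTerm P f t μ

variable {P : ℝ → X →L[ℝ] X} {f g : ℝ → X} {T t μ : ℝ}

theorem memLp_mono_Ioc {E : Type*} [NormedAddCommGroup E] {f : ℝ → E}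
    (hf : MemLp f 2 (volume.restrict (Ioc 0 T))) (htT : t ≤ T) :
    MemLp f 2 (volume.restrict (Ioc 0 t)) :=
  hf.mono_measure (Measure.restrict_mono (Ioc_subset_Ioc_right htT) le_rfl)

theorem integrableOn_of_memLp_two {E : Type*} [NormedAddCommGroup E] {f : ℝ → E}
    (hf : MemLp f 2 (volume.restrict (Ioc 0 T))) : IntegrableOn f (Ioc 0 T) :=
  hf.integrable (by norm_num)

theorem integrableOn_duhamel (hf : MemLp f 2 (volume.restrict (Ioc 0 T))) (L : X →L[ℝ] X)
    {w : ℝ → ℝ} (hw : Continuous w) : IntegrableOn (fun s => w s • L (f s)) (Ioc 0 T) := by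
  have h1 : IntegrableOn (fun s => L (f s)) (Icc 0 T) :=
    (integrableOn_Icc_iff_integrableOn_Ioc).2 (L.integrable_comp (integrableOn_of_memLp_two hf))
  exact (h1.continuousOn_smul hw.continuousOn isCompact_Icc).mono_set Ioc_subset_Icc_self

theorem intervalIntegrable_duhamel (hf : MemLp f 2 (volume.restrict (Ioc 0 T))) (L : X →L[ℝ] X)
    {w : ℝ → ℝ} (hw : Continuous w) (ht : 0 ≤ t) (htT : t ≤ T) :
    IntervalIntegrable (fun s => w s • L (f s)) volume 0 t :=
  (intervalIntegrable_iff_integrableOn_Ioc_of_le ht).2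
    (integrableOn_duhamel (memLp_mono_Ioc hf htT) L hw)

theorem integrable_norm_sq {E : Type*} [NormedAddCommGroup E] {f : ℝ → E}
    (hf : MemLp f 2 (volume.restrict (Ioc 0 T))) (L : E → ℝ) (hLm : Continuous L)
    (hL : ∀ x, |L x| ≤ ‖x‖) : IntegrableOn (fun s => L (f s) ^ 2) (Ioc 0 T) := by
  have : MemLp (fun s => L (f s)) 2 (volume.restrict (Ioc 0 T)) :=
    hf.mono (hLm.comp_aestronglyMeasurable hf.1) (Filter.Eventually.of_forall fun s => hL _)
  exact this.integrable_sq

theorem norm_sq_duhamelTerm_le (hP : SpectralResolution P)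
    (hf : MemLp f 2 (volume.restrict (Ioc 0 t))) (ht : 0 ≤ t) (ht3 : t ≤ 3) (μ : ℝ) :
    ‖duhamelTerm P f t μ‖ ^ 2 ≤ 4 * ∫ s in (0 : ℝ)..t, ‖P μ (f s)‖ ^ 2 := by
  have hnn : 0 ≤ ∫ s in (0 : ℝ)..t, ‖P μ (f s)‖ ^ 2 :=
    intervalIntegral.integral_nonneg ht fun s _ => sq_nonneg _
  rcases lt_or_ge μ 0 with hμ | hμ
  · simp [duhamelTerm, hP.neg μ _ hμ]
  have h1 : ‖∫ s in (0 : ℝ)..t, Real.exp (-μ * (t - s)) • P μ (f s)‖ ^ 2 ≤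
      (∫ s in (0 : ℝ)..t, Real.exp (-μ * (t - s)) ^ 2) * ∫ s in (0 : ℝ)..t, ‖P μ (f s)‖ ^ 2 := by
    have hk : MemLp (fun s => Real.exp (-μ * (t - s))) 2 (volume.restrict (Ioc 0 t)) :=
      (MemLp.of_bound (C := 1) (by fun_prop) (by
        refine (ae_restrict_iff' measurableSet_Ioc).2 (Filter.Eventually.of_forall fun s hs => ?_)
        rw [Real.norm_eq_abs, Real.abs_exp, Real.exp_le_one_iff]
        nlinarith [hs.2]))
    have hg : MemLp (fun s => ‖P μ (f s)‖) 2 (volume.restrict (Ioc 0 t)) :=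
      ((P μ).comp_memLp' hf).norm
    have h := integral_mul_sq_le hk hg (fun _ => Real.exp_nonneg _) fun _ => norm_nonneg _
    simp only [intervalIntegral.integral_of_le ht]
    refine le_trans (pow_le_pow_left₀ (norm_nonneg _) ?_ 2) h
    refine (norm_integral_le_integral_norm _).trans (le_of_eq ?_)
    simp [norm_smul]
  rw [duhamelTerm, norm_smul, mul_pow, Real.norm_eq_abs, sq_abs, Real.sq_sqrt (by linarith)]
  calc _ ≤ (1 + μ) * ((∫ s in (0 : ℝ)..t, Real.exp (-μ * (t - s)) ^ 2) *
        ∫ s in (0 : ℝ)..t, ‖P μ (f s)‖ ^ 2) := by gcongr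
    _ = ((1 + μ) * ∫ s in (0 : ℝ)..t, Real.exp (-μ * (t - s)) ^ 2) *
        ∫ s in (0 : ℝ)..t, ‖P μ (f s)‖ ^ 2 := by ring
    _ ≤ _ := mul_le_mul_of_nonneg_right (one_add_mul_integral_exp_le hμ ht ht3) hnn

theorem sum_integral_proj_le (hP : SpectralResolution P)
    (hf : MemLp f 2 (volume.restrict (Ioc 0 t))) (ht : 0 ≤ t) (F : Finset ℝ) :
    ∑ μ ∈ F, ∫ s in (0 : ℝ)..t, ‖P μ (f s)‖ ^ 2 ≤ ∫ s in (0 : ℝ)..t, ‖f s‖ ^ 2 := by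
  simp only [intervalIntegral.integral_of_le ht]
  have hi : ∀ μ, IntegrableOn (fun s => ‖P μ (f s)‖ ^ 2) (Ioc 0 t) := fun μ =>
    integrable_norm_sq hf (fun x => ‖P μ x‖) (by fun_prop) fun x => by
      rw [abs_norm]; exact hP.norm_le μ x
  rw [← integral_finsetSum _ fun μ _ => hi μ]
  refine integral_mono (integrable_finsetSum _ fun μ _ => hi μ)
    (integrable_norm_sq hf (fun x => ‖x‖) continuous_norm fun x => by simp) fun s => ?_
  exact sum_le_hasSum F (fun _ _ => sq_nonneg _) (hP.hasSum_norm_sq (f s))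

theorem summable_integral_proj (hP : SpectralResolution P)
    (hf : MemLp f 2 (volume.restrict (Ioc 0 t))) (ht : 0 ≤ t) :
    Summable fun μ => ∫ s in (0 : ℝ)..t, ‖P μ (f s)‖ ^ 2 :=
  summable_of_sum_le (fun _ => intervalIntegral.integral_nonneg ht fun _ _ => sq_nonneg _)
    (sum_integral_proj_le hP hf ht)

theorem summable_duhamelTerm (hP : SpectralResolution P)
    (hf : MemLp f 2 (volume.restrict (Ioc 0 t))) (ht : 0 ≤ t) (ht3 : t ≤ 3) :
    Summable fun μ => ‖duhamelTerm P f t μ‖ ^ 2 :=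
  Summable.of_nonneg_of_le (fun _ => sq_nonneg _) (norm_sq_duhamelTerm_le hP hf ht ht3)
    ((summable_integral_proj hP hf ht).mul_left 4)

variable [CompleteSpace X]

theorem proj_duhamelTerm (hP : SpectralResolution P)
    (hf : MemLp f 2 (volume.restrict (Ioc 0 t))) (ht : 0 ≤ t) (μ : ℝ) :
    P μ (duhamelTerm P f t μ) = duhamelTerm P f t μ := by
  rw [duhamelTerm, map_smul, ← (P μ).intervalIntegral_comp_comm
    (intervalIntegrable_duhamel hf (P μ) (by fun_prop) ht le_rfl)]
  simp only [map_smul, hP.idem]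

theorem proj_duhamel (hP : SpectralResolution P)
    (hf : MemLp f 2 (volume.restrict (Ioc 0 t))) (ht : 0 ≤ t) (ht3 : t ≤ 3) (μ : ℝ) :
    P μ (duhamel P f t) = duhamelTerm P f t μ :=
  hP.proj_tsum (proj_duhamelTerm hP hf ht) (summable_duhamelTerm hP hf ht ht3) μ

/-- The kernel bound is uniform in `μ`, so the factor `(1 + A)^{1/2}` costs only a constant; the
components of `f` are then summed by Parseval. -/
theorem norm_sq_duhamel_le (hP : SpectralResolution P)
    (hf : MemLp f 2 (volume.restrict (Ioc 0 t))) (ht : 0 ≤ t) (ht3 : t ≤ 3) :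
    ‖duhamel P f t‖ ^ 2 ≤ 4 * ∫ s in (0 : ℝ)..t, ‖f s‖ ^ 2 := by
  rw [duhamel, hP.norm_sq_tsum (proj_duhamelTerm hP hf ht) (summable_duhamelTerm hP hf ht ht3)]
  calc _ ≤ ∑' μ, 4 * ∫ s in (0 : ℝ)..t, ‖P μ (f s)‖ ^ 2 :=
        Summable.tsum_le_tsum (norm_sq_duhamelTerm_le hP hf ht ht3)
          (summable_duhamelTerm hP hf ht ht3) ((summable_integral_proj hP hf ht).mul_left 4)
    _ = 4 * ∑' μ, ∫ s in (0 : ℝ)..t, ‖P μ (f s)‖ ^ 2 := tsum_mul_left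
    _ ≤ _ := by
        gcongr
        exact (summable_integral_proj hP hf ht).tsum_le_of_sum_le (sum_integral_proj_le hP hf ht)

theorem continuousOn_duhamel (hP : SpectralResolution P)
    (hf : MemLp f 2 (volume.restrict (Ioc 0 T))) (hT : 0 ≤ T) (hT3 : T ≤ 3) :
    ContinuousOn (duhamel P f) (Icc 0 T) := by
  refine hP.continuousOn_tsum (g := fun μ => 4 * ∫ s in (0 : ℝ)..T, ‖P μ (f s)‖ ^ 2)
    (fun t ht => proj_duhamelTerm hP (memLp_mono_Ioc hf ht.2) ht.1) (fun μ => ?_)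
    ((summable_integral_proj hP hf hT).mul_left 4) fun t ht μ => ?_
  -- Pulling `e^{-μt}` out of the integral leaves a primitive of a fixed integrable function, which
  -- is continuous in `t`.
  · have h1 : ∀ t, duhamelTerm P f t μ = √(1 + μ) • Real.exp (-μ * t) •
        ∫ s in (0 : ℝ)..t, Real.exp (μ * s) • P μ (f s) := by
      intro t
      rw [duhamelTerm, ← intervalIntegral.integral_smul (Real.exp (-μ * t))]
      refine congrArg _ (intervalIntegral.integral_congr fun s _ => ?_)
      rw [smul_smul, ← Real.exp_add]
      congr 2; ring
    simp only [h1]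
    refine continuousOn_const.smul ((by fun_prop : Continuous fun t : ℝ =>
      Real.exp (-μ * t)).continuousOn.smul ?_)
    refine (intervalIntegral.continuousOn_primitive_interval
      (f := fun s => Real.exp (μ * s) • P μ (f s)) (μ := volume) (a := 0) (b := T) ?_).mono
      (by rw [uIcc_of_le hT])
    rw [uIcc_of_le hT, integrableOn_Icc_iff_integrableOn_Ioc]
    exact integrableOn_duhamel hf (P μ) (by fun_prop)
  · refine (norm_sq_duhamelTerm_le hP (memLp_mono_Ioc hf ht.2) ht.1 (ht.2.trans hT3) μ).trans ?_
    gcongr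
    refine intervalIntegral.integral_mono_interval le_rfl ht.1 ht.2
      (Filter.Eventually.of_forall fun s => sq_nonneg _) ?_
    refine (intervalIntegrable_iff_integrableOn_Ioc_of_le hT).2 ?_
    exact integrable_norm_sq hf (fun x => ‖P μ x‖) (by fun_prop) fun x => by
      rw [abs_norm]; exact hP.norm_le μ x

end Duhamel

/-! ### The reduced bilinear equation: concatenation, a priori bound, existence -/

section Reduced

variable {X : Type*} [NormedAddCommGroup X] [InnerProductSpace ℝ X]

/-- The mild solution `u` of the bilinear problem, written for `h = (1 + A)^{1/2} u` and in spectral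
components; `G` stands for `B (1 + A)^{-1/2}`. -/
structure IsReducedSolution (P : ℝ → X →L[ℝ] X) (G : X →L[ℝ] X) (T : ℝ) (h₀ : X) (p : ℝ → ℝ)
    (h : ℝ → X) : Prop where
  continuousOn : ContinuousOn h (Icc 0 T)
  proj_eq : ∀ t ∈ Icc 0 T, ∀ μ, P μ (h t) =
    Real.exp (-μ * t) • P μ h₀ - duhamelTerm P (fun s => p s • G (h s)) t μ

variable {P : ℝ → X →L[ℝ] X} {G : X →L[ℝ] X} {T T' t η M : ℝ} {h₀ h₀' : X} {p p' : ℝ → ℝ}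
  {h h' f g : ℝ → X}

theorem memLp_control_smul (hp : MemLp p 2 (volume.restrict (Ioc 0 T)))
    (hc : ContinuousOn h (Icc 0 T)) (G : X →L[ℝ] X) :
    MemLp (fun s => p s • G (h s)) 2 (volume.restrict (Ioc 0 T)) := by
  have hc' : ContinuousOn (fun s => G (h s)) (Icc 0 T) := G.continuous.comp_continuousOn hc
  obtain ⟨C, hC⟩ := isCompact_Icc.exists_bound_of_continuousOn hc'
  refine MemLp.of_le_mul (c := C) hp (hp.1.smul
    ((hc'.mono Ioc_subset_Icc_self).aestronglyMeasurable measurableSet_Ioc)) ?_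
  · refine (ae_restrict_iff' measurableSet_Ioc).2 (Filter.Eventually.of_forall fun s hs => ?_)
    rw [norm_smul, mul_comm]
    exact mul_le_mul_of_nonneg_right (hC s (Ioc_subset_Icc_self hs)) (norm_nonneg _)

theorem duhamelTerm_congr (ht : 0 ≤ t) (hfg : ∀ s ∈ Ioc 0 t, f s = g s) (μ : ℝ) :
    duhamelTerm P f t μ = duhamelTerm P g t μ := by
  unfold duhamelTerm
  rw [intervalIntegral.integral_of_le ht, intervalIntegral.integral_of_le ht]
  refine congrArg _ (setIntegral_congr_fun measurableSet_Ioc fun s hs => ?_)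
  simp only [hfg s hs]

theorem duhamelTerm_smul (c : ℝ) (μ : ℝ) :
    duhamelTerm P (fun s => c • f s) t μ = c • duhamelTerm P f t μ := by
  unfold duhamelTerm
  rw [smul_comm c, ← intervalIntegral.integral_smul c]
  simp only [map_smul, smul_comm c]

theorem duhamelTerm_sub (hf : MemLp f 2 (volume.restrict (Ioc 0 t)))
    (hg : MemLp g 2 (volume.restrict (Ioc 0 t))) (ht : 0 ≤ t) (μ : ℝ) :
    duhamelTerm P (fun s => f s - g s) t μ = duhamelTerm P f t μ - duhamelTerm P g t μ := by
  unfold duhamelTerm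
  rw [← smul_sub, ← intervalIntegral.integral_sub
    (intervalIntegrable_duhamel hf (P μ) (by fun_prop) ht le_rfl)
    (intervalIntegrable_duhamel hg (P μ) (by fun_prop) ht le_rfl)]
  simp only [map_sub, smul_sub]

theorem IsReducedSolution.congr (H : IsReducedSolution P G T h₀ p h)
    (hp : ∀ s ∈ Ioc 0 T, p' s = p s) : IsReducedSolution P G T h₀ p' h where
  continuousOn := H.continuousOn
  proj_eq t ht μ := by
    rw [H.proj_eq t ht μ, duhamelTerm_congr (f := fun s => p s • G (h s))
      (g := fun s => p' s • G (h s)) ht.1 fun s hs => by rw [hp s ⟨hs.1, hs.2.trans ht.2⟩]]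

theorem IsReducedSolution.mono (H : IsReducedSolution P G T h₀ p h) (hT : T' ≤ T) :
    IsReducedSolution P G T' h₀ p h where
  continuousOn := H.continuousOn.mono (Icc_subset_Icc_right hT)
  proj_eq t ht μ := H.proj_eq t ⟨ht.1, ht.2.trans hT⟩ μ

theorem IsReducedSolution.smul (H : IsReducedSolution P G T h₀ p h) (c : ℝ) :
    IsReducedSolution P G T (c • h₀) p (fun t => c • h t) where
  continuousOn := H.continuousOn.const_smul c
  proj_eq t ht μ := by
    simp only [map_smul, smul_comm _ c]
    rw [duhamelTerm_smul, H.proj_eq t ht μ, smul_sub]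

theorem IsReducedSolution.sub (hp : MemLp p 2 (volume.restrict (Ioc 0 T)))
    (H : IsReducedSolution P G T h₀ p h) (H' : IsReducedSolution P G T h₀' p h') :
    IsReducedSolution P G T (h₀ - h₀') p (fun t => h t - h' t) where
  continuousOn := H.continuousOn.sub H'.continuousOn
  proj_eq t ht μ := by
    simp only [map_sub, smul_sub]
    rw [duhamelTerm_sub (memLp_mono_Ioc (memLp_control_smul hp H.continuousOn G) ht.2)
      (memLp_mono_Ioc (memLp_control_smul hp H'.continuousOn G) ht.2) ht.1,
      H.proj_eq t ht μ, H'.proj_eq t ht μ]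
    abel

theorem IsReducedSolution.apply_zero (hP : SpectralResolution P) (hT : 0 ≤ T)
    (H : IsReducedSolution P G T h₀ p h) : h 0 = h₀ :=
  hP.ext fun μ => by simpa [duhamelTerm] using H.proj_eq 0 ⟨le_rfl, hT⟩ μ

theorem IsReducedSolution.concat (hP : SpectralResolution P) (hT : 0 ≤ T) (hT' : 0 ≤ T')
    (hp : MemLp p 2 (volume.restrict (Ioc 0 (T + T'))))
    (H : IsReducedSolution P G T h₀ p h)
    (H' : IsReducedSolution P G T' (h T) (fun s => p (T + s)) h') :
    IsReducedSolution P G (T + T') h₀ p (fun t => if t ≤ T then h t else h' (t - T)) := by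
  have h0 := H'.apply_zero hP hT'
  set k : ℝ → X := fun t => if t ≤ T then h t else h' (t - T) with hk
  have k1 : ∀ t ≤ T, k t = h t := fun t ht => if_pos ht
  have k2 : ∀ t, T ≤ t → k t = h' (t - T) := by
    intro t ht
    rcases ht.eq_or_lt with rfl | ht
    · rw [k1 _ le_rfl, sub_self, h0]
    · exact if_neg ht.not_ge
  have hkc : ContinuousOn k (Icc 0 (T + T')) := by
    rw [← Icc_union_Icc_eq_Icc hT (by linarith : T ≤ T + T')]
    refine ContinuousOn.union_of_isClosed (H.continuousOn.congr fun t ht => k1 t ht.2)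
      (ContinuousOn.congr (f := fun t => h' (t - T)) ?_ fun t ht => k2 t ht.1)
      isClosed_Icc isClosed_Icc
    exact H'.continuousOn.comp (by fun_prop) fun t ht => ⟨by linarith [ht.1], by linarith [ht.2]⟩
  refine ⟨hkc, fun t ht μ => ?_⟩
  have hf := memLp_control_smul hp hkc G
  rcases le_total t T with htT | htT
  · rw [k1 t htT, H.proj_eq t ⟨ht.1, htT⟩ μ,
      duhamelTerm_congr (f := fun s => p s • G (k s)) (g := fun s => p s • G (h s)) ht.1
        fun s hs => by rw [k1 s (hs.2.trans htT)]]
  · rw [k2 t htT, H'.proj_eq (t - T) ⟨by linarith, by linarith [ht.2]⟩ μ,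
      H.proj_eq T ⟨hT, le_rfl⟩ μ]
    -- The integral up to `t` splits at `T`: the first part is `e^{-μ(t-T)}` times the Duhamel
    -- integral at `T`, the second is a translate.
    have hi : ∀ a, 0 ≤ a → a ≤ T + T' → IntervalIntegrable
        (fun s => Real.exp (-μ * (t - s)) • P μ (p s • G (k s))) volume 0 a := fun a ha ha' =>
      intervalIntegrable_duhamel hf (P μ) (by fun_prop) ha ha'
    have hsplit := intervalIntegral.integral_add_adjacent_intervals (hi T hT (by linarith))
      ((hi T hT (by linarith)).symm.trans (hi t ht.1 ht.2))
    have e1 : ∫ s in (0 : ℝ)..T, Real.exp (-μ * (t - s)) • P μ (p s • G (k s)) =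
        Real.exp (-μ * (t - T)) •
          ∫ s in (0 : ℝ)..T, Real.exp (-μ * (T - s)) • P μ (p s • G (h s)) := by
      rw [← intervalIntegral.integral_smul]
      refine intervalIntegral.integral_congr fun s hs => ?_
      rw [uIcc_of_le hT] at hs
      rw [k1 s hs.2, smul_smul, ← Real.exp_add]
      congr 2; ring
    have e2 : ∫ s in T..t, Real.exp (-μ * (t - s)) • P μ (p s • G (k s)) =
        ∫ s in (0 : ℝ)..(t - T), Real.exp (-μ * (t - T - s)) • P μ (p (T + s) • G (h' s)) := by
      have e3 := intervalIntegral.integral_comp_add_left (a := 0) (b := t - T)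
        (fun s => Real.exp (-μ * (t - s)) • P μ (p s • G (k s))) T
      rw [add_zero, add_sub_cancel] at e3
      rw [← e3]
      refine intervalIntegral.integral_congr fun s hs => ?_
      rw [uIcc_of_le (by linarith)] at hs
      rw [k2 (T + s) (by linarith [hs.1]), add_sub_cancel_left, sub_add_eq_sub_sub]
    unfold duhamelTerm
    rw [← hsplit, e1, e2, smul_sub, smul_smul, ← Real.exp_add, smul_add,
      smul_comm (Real.exp (-μ * (t - T))) (√(1 + μ))]
    rw [show -μ * (t - T) + -μ * T = -μ * t by ring]
    abel

variable [CompleteSpace X]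

theorem norm_duhamel_control_le (hP : SpectralResolution P)
    (hp : MemLp p 2 (volume.restrict (Ioc 0 T))) (hη : 0 ≤ η)
    (hpη : ∫ s in (0 : ℝ)..T, p s ^ 2 ≤ η ^ 2) (hT3 : T ≤ 3) (hc : ContinuousOn h (Icc 0 T))
    (hM0 : 0 ≤ M) (hM : ∀ s ∈ Icc 0 T, ‖h s‖ ≤ M) (ht : t ∈ Icc 0 T) :
    ‖duhamel P (fun s => p s • G (h s)) t‖ ≤ 2 * η * ‖G‖ * M := by
  have hf := memLp_control_smul hp hc G
  refine le_of_sq_le_sq ?_ (by positivity)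
  refine (norm_sq_duhamel_le hP (memLp_mono_Ioc hf ht.2) ht.1 (ht.2.trans hT3)).trans ?_
  have hT : 0 ≤ T := ht.1.trans ht.2
  have hpi : IntervalIntegrable (fun s => p s ^ 2) volume 0 T :=
    (intervalIntegrable_iff_integrableOn_Ioc_of_le hT).2 hp.integrable_sq
  have hfi : IntervalIntegrable (fun s => ‖p s • G (h s)‖ ^ 2) volume 0 T :=
    (intervalIntegrable_iff_integrableOn_Ioc_of_le hT).2
      (integrable_norm_sq hf (fun x => ‖x‖) continuous_norm fun x => by simp)
  calc 4 * ∫ s in (0 : ℝ)..t, ‖p s • G (h s)‖ ^ 2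
      ≤ 4 * ∫ s in (0 : ℝ)..T, ‖p s • G (h s)‖ ^ 2 := by
        gcongr
        exact intervalIntegral.integral_mono_interval le_rfl ht.1 ht.2
          (Filter.Eventually.of_forall fun s => sq_nonneg _) hfi
    _ ≤ 4 * ∫ s in (0 : ℝ)..T, p s ^ 2 * (‖G‖ * M) ^ 2 := by
        gcongr
        refine intervalIntegral.integral_mono_on hT hfi (hpi.mul_const _) fun s hs => ?_
        rw [norm_smul, mul_pow, Real.norm_eq_abs, sq_abs]
        gcongr
        exact (G.le_opNorm _).trans (by gcongr; exact hM s hs)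
    _ = 4 * (∫ s in (0 : ℝ)..T, p s ^ 2) * (‖G‖ * M) ^ 2 := by
        rw [intervalIntegral.integral_mul_const]; ring
    _ ≤ 4 * η ^ 2 * (‖G‖ * M) ^ 2 := by gcongr
    _ = _ := by ring

theorem abs_exp_neg_mul_le_one {t : ℝ} (ht : 0 ≤ t) (μ : ℝ) (hμ : 0 ≤ μ) :
    |Real.exp (-μ * t)| ≤ 1 := by
  rw [Real.abs_exp, Real.exp_le_one_iff]
  nlinarith

theorem continuousOn_spectralMul_exp (hP : SpectralResolution P) (x : X) (T : ℝ) :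
    ContinuousOn (fun t => spectralMul P (fun μ => Real.exp (-μ * t)) x) (Icc 0 T) := by
  refine hP.continuousOn_tsum (g := fun μ => ‖P μ x‖ ^ 2)
    (fun t ht μ => hP.proj_smul_idem (fun μ => Real.exp (-μ * t)) x μ) (fun μ => by fun_prop)
    (hP.summable_norm_sq x) fun t ht μ => ?_
  rcases lt_or_ge μ 0 with hμ | hμ
  · simp [hP.neg μ x hμ]
  · rw [norm_smul]
    exact pow_le_pow_left₀ (by positivity)
      (mul_le_of_le_one_left (norm_nonneg _) (abs_exp_neg_mul_le_one ht.1 μ hμ)) 2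

theorem IsReducedSolution.apply_eq (hP : SpectralResolution P)
    (hp : MemLp p 2 (volume.restrict (Ioc 0 T))) (hT3 : T ≤ 3)
    (H : IsReducedSolution P G T h₀ p h) (ht : t ∈ Icc 0 T) :
    h t = spectralMul P (fun μ => Real.exp (-μ * t)) h₀ -
      duhamel P (fun s => p s • G (h s)) t := by
  have hf := memLp_control_smul hp H.continuousOn G
  refine hP.ext fun μ => ?_
  rw [map_sub, hP.proj_spectralMul (abs_exp_neg_mul_le_one ht.1),
    proj_duhamel hP (memLp_mono_Ioc hf ht.2) ht.1 (ht.2.trans hT3), H.proj_eq t ht]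

/-- At a maximum of `‖h‖` the Duhamel term is at most half of that maximum, because `2η‖G‖ ≤ 1/2`,
and is absorbed. -/
theorem IsReducedSolution.norm_le (hP : SpectralResolution P)
    (hp : MemLp p 2 (volume.restrict (Ioc 0 T))) (hη : 0 ≤ η)
    (hpη : ∫ s in (0 : ℝ)..T, p s ^ 2 ≤ η ^ 2) (hGη : 4 * η * ‖G‖ ≤ 1) (hT3 : T ≤ 3)
    (H : IsReducedSolution P G T h₀ p h) (ht : t ∈ Icc 0 T) : ‖h t‖ ≤ 2 * ‖h₀‖ := by
  obtain ⟨t₁, ht₁, hmax⟩ := isCompact_Icc.exists_isMaxOn ⟨t, ht⟩ H.continuousOn.norm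
  have h1 : ‖h t₁‖ ≤ ‖h₀‖ + 2 * η * ‖G‖ * ‖h t₁‖ := by
    conv_lhs => rw [H.apply_eq hP hp hT3 ht₁]
    refine (norm_sub_le _ _).trans (add_le_add ?_ ?_)
    · simpa using hP.norm_spectralMul_le (abs_exp_neg_mul_le_one ht₁.1) h₀
    · exact norm_duhamel_control_le hP hp hη hpη hT3 H.continuousOn (norm_nonneg _)
        (fun s hs => hmax hs) ht₁
  have h2 : ‖h t‖ ≤ ‖h t₁‖ := hmax ht
  nlinarith [norm_nonneg (h t₁)]

theorem IsReducedSolution.unique (hP : SpectralResolution P)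
    (hp : MemLp p 2 (volume.restrict (Ioc 0 T))) (hη : 0 ≤ η)
    (hpη : ∫ s in (0 : ℝ)..T, p s ^ 2 ≤ η ^ 2) (hGη : 4 * η * ‖G‖ ≤ 1) (hT3 : T ≤ 3)
    (H : IsReducedSolution P G T h₀ p h) (H' : IsReducedSolution P G T h₀ p h')
    (ht : t ∈ Icc 0 T) : h t = h' t := by
  have h1 := (H.sub hp H').norm_le hP hp hη hpη hGη hT3 ht
  rw [sub_self, norm_zero, mul_zero] at h1
  exact sub_eq_zero.1 (norm_le_zero_iff.1 h1)

/-- Banach's fixed point theorem on `C([0,T]; X)` with contraction constant `2η‖G‖ ≤ 1/2`. Smallness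
of the control, not of the time, yields a solution on the whole closed interval. -/
theorem exists_isReducedSolution (hP : SpectralResolution P)
    (hp : MemLp p 2 (volume.restrict (Ioc 0 T))) (hη : 0 ≤ η)
    (hpη : ∫ s in (0 : ℝ)..T, p s ^ 2 ≤ η ^ 2) (hGη : 4 * η * ‖G‖ ≤ 1) (hT : 0 ≤ T) (hT3 : T ≤ 3)
    (h₀ : X) : ∃ h, IsReducedSolution P G T h₀ p h := by
  have hext : ∀ k : C(Icc 0 T, X), ContinuousOn (IccExtend hT k) (Icc 0 T) := fun k =>
    k.continuous.Icc_extend'.continuousOn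
  have hf : ∀ k : C(Icc 0 T, X),
      MemLp (fun s => p s • G (IccExtend hT k s)) 2 (volume.restrict (Ioc 0 T)) := fun k =>
    memLp_control_smul hp (hext k) G
  let F : C(Icc 0 T, X) → C(Icc 0 T, X) := fun k =>
    ⟨fun t => spectralMul P (fun μ => Real.exp (-μ * t)) h₀ -
      duhamel P (fun s => p s • G (IccExtend hT k s)) t,
      continuousOn_iff_continuous_domRestrict.1
        ((continuousOn_spectralMul_exp hP h₀ T).sub (continuousOn_duhamel hP (hf k) hT hT3))⟩
  have hFa : ∀ k t, F k t = spectralMul P (fun μ => Real.exp (-μ * (t : ℝ))) h₀ -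
      duhamel P (fun s => p s • G (IccExtend hT k s)) t := fun _ _ => rfl
  have hF : ContractingWith (1 / 2) F := by
    refine ⟨by norm_num, LipschitzWith.of_dist_le_mul fun k l => ?_⟩
    refine (ContinuousMap.dist_le (by positivity)).2 fun t => ?_
    have e1 : F k t - F l t =
        duhamel P (fun s => p s • G (IccExtend hT l s - IccExtend hT k s)) t := by
      refine hP.ext fun μ => ?_
      have hmem : MemLp (fun s => p s • G (IccExtend hT l s - IccExtend hT k s)) 2
          (volume.restrict (Ioc 0 T)) := memLp_control_smul hp ((hext l).sub (hext k)) G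
      have ht3 := t.2.2.trans hT3
      simp only [hFa, map_sub]
      rw [proj_duhamel hP (memLp_mono_Ioc (hf k) t.2.2) t.2.1 ht3,
        proj_duhamel hP (memLp_mono_Ioc (hf l) t.2.2) t.2.1 ht3]
      simp only [smul_sub]
      rw [proj_duhamel hP ?_ t.2.1 ht3, duhamelTerm_sub (memLp_mono_Ioc (hf l) t.2.2)
        (memLp_mono_Ioc (hf k) t.2.2) t.2.1]
      · abel
      · exact (memLp_mono_Ioc (hf l) t.2.2).sub (memLp_mono_Ioc (hf k) t.2.2)
    rw [dist_eq_norm, e1]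
    refine (norm_duhamel_control_le hP hp hη hpη hT3 ((hext l).sub (hext k))
      (dist_nonneg (x := k) (y := l)) (fun s hs => ?_) t.2).trans ?_
    · rw [Pi.sub_apply, IccExtend_of_mem _ _ hs, IccExtend_of_mem _ _ hs, dist_comm, dist_eq_norm]
      exact ContinuousMap.norm_coe_le_norm (l - k) ⟨s, hs⟩
    · have : ((1 / 2 : NNReal) : ℝ) = 1 / 2 := by norm_num
      rw [this]
      exact mul_le_mul_of_nonneg_right (by linarith) dist_nonneg
  let k := hF.fixedPoint
  have hk : F k = k := hF.fixedPoint_isFixedPt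
  refine ⟨IccExtend hT k, hext k, fun t ht μ => ?_⟩
  conv_lhs => rw [IccExtend_of_mem hT k ht, ← hk]
  rw [hFa, map_sub, hP.proj_spectralMul (abs_exp_neg_mul_le_one ht.1),
    proj_duhamel hP (memLp_mono_Ioc (hf k) ht.2) ht.1 (ht.2.trans hT3)]

end Reduced

/-! ### Gluing countably many controls -/

section Gluing

theorem memLp_translate {τ : ℝ} {p : ℝ → ℝ} (hp : MemLp p 2 (volume.restrict (Ioc 0 τ)))
    (a : ℝ) : MemLp (fun s => p (s - a)) 2 (volume.restrict (Ioc a (a + τ))) := by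
  have h := (measurePreserving_sub_right (volume : Measure ℝ) a).restrict_preimage
    (measurableSet_Ioc (a := 0) (b := τ))
  rw [preimage_sub_const_Ioc, zero_add, add_comm] at h
  exact hp.comp_measurePreserving h

theorem memLp_two_union {p : ℝ → ℝ} {s t : Set ℝ} (hs : MemLp p 2 (volume.restrict s))
    (ht : MemLp p 2 (volume.restrict t)) : MemLp p 2 (volume.restrict (s ∪ t)) := by
  rw [memLp_two_iff_integrable_sq (aestronglyMeasurable_union_iff.2 ⟨hs.1, ht.1⟩)]
  exact IntegrableOn.union hs.integrable_sq ht.integrable_sq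

theorem exists_glued_control {t : ℕ → ℝ} (ht : Monotone t) (ht0 : t 0 = 0) {T : ℝ}
    (htT : Filter.Tendsto t Filter.atTop (nhds T)) {q : ℕ → ℝ → ℝ}
    (hq : ∀ n, MemLp (q n) 2 (volume.restrict (Ioc 0 (t (n + 1) - t n)))) {b : ℕ → ℝ}
    (hb : ∀ n, ∫ s in (0 : ℝ)..(t (n + 1) - t n), q n s ^ 2 ≤ b n) (hbs : Summable b) :
    ∃ p : ℝ → ℝ, MemLp p 2 (volume.restrict (Ioc 0 T)) ∧
      ∫ s in (0 : ℝ)..T, p s ^ 2 ≤ ∑' n, b n ∧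
      ∀ n, ∀ s ∈ Ioc 0 (t (n + 1) - t n), p (t n + s) = q n s := by
  classical
  have hdisj : Pairwise (Function.onFun Disjoint fun n => Ioc (t n) (t (n + 1))) :=
    ht.pairwise_disjoint_on_Ioc_succ
  have hle : ∀ n, t n ≤ t (n + 1) := fun n => ht n.le_succ
  let p : ℝ → ℝ := fun s => if h : ∃ n, s ∈ Ioc (t n) (t (n + 1)) then
    q h.choose (s - t h.choose) else 0
  have hp : ∀ n, ∀ s ∈ Ioc (t n) (t (n + 1)), p s = q n (s - t n) := by
    intro n s hs
    have h : ∃ n, s ∈ Ioc (t n) (t (n + 1)) := ⟨n, hs⟩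
    have hn : h.choose = n := by
      by_contra hne
      exact disjoint_left.1 (hdisj hne) h.choose_spec hs
    simp only [p, dif_pos h, hn]
  have hp' : ∀ n, ∀ s ∈ Ioc 0 (t (n + 1) - t n), p (t n + s) = q n s := by
    intro n s hs
    rw [hp n _ ⟨by linarith [hs.1], by linarith [hs.2]⟩, add_sub_cancel_left]
  have hmem : ∀ n, MemLp p 2 (volume.restrict (Ioc (t n) (t (n + 1)))) := by
    intro n
    have h := memLp_translate (hq n) (t n)
    rw [add_sub_cancel] at h
    refine h.ae_eq ?_
    exact (ae_restrict_iff' measurableSet_Ioc).2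
      (Filter.Eventually.of_forall fun s hs => (hp n s hs).symm)
  have hint : ∀ n, ∫ s in Ioc (t n) (t (n + 1)), p s ^ 2 ≤ b n := by
    intro n
    refine le_trans (le_of_eq ?_) (hb n)
    have h := intervalIntegral.integral_comp_add_left (a := 0) (b := t (n + 1) - t n)
      (fun s => p s ^ 2) (t n)
    rw [add_zero, add_sub_cancel, intervalIntegral.integral_of_le (hle n)] at h
    rw [← h, intervalIntegral.integral_of_le (sub_nonneg.2 (hle n)),
      intervalIntegral.integral_of_le (sub_nonneg.2 (hle n))]
    exact setIntegral_congr_fun measurableSet_Ioc fun s hs => by simp only [hp' n s hs]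
  have hnn : ∀ n, 0 ≤ ∫ s in Ioc (t n) (t (n + 1)), p s ^ 2 := fun n =>
    integral_nonneg fun s => sq_nonneg _
  have hsum : Summable fun n => ∫ s in Ioc (t n) (t (n + 1)), p s ^ 2 :=
    Summable.of_nonneg_of_le hnn hint hbs
  have hU : IntegrableOn (fun s => p s ^ 2) (⋃ n, Ioc (t n) (t (n + 1))) := by
    refine integrableOn_iUnion_of_summable_integral_norm (fun n => (hmem n).integrable_sq) ?_
    simpa using hsum
  -- The union can miss the endpoint `T`, so the sets agree only up to a null set.
  have hUae : (⋃ n, Ioc (t n) (t (n + 1)) : Set ℝ) =ᵐ[volume] Ioc 0 T := by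
    have hsub : (⋃ n, Ioc (t n) (t (n + 1)) : Set ℝ) ⊆ Ioc 0 T := by
      refine iUnion_subset fun n => Ioc_subset_Ioc ?_ (ht.ge_of_tendsto htT _)
      rw [← ht0]; exact ht n.zero_le
    refine (Filter.EventuallyLE.antisymm (Filter.Eventually.of_forall hsub) ?_)
    refine Filter.EventuallyLE.trans Ioo_ae_eq_Ioc.symm.le (Filter.Eventually.of_forall ?_)
    intro s hs
    have hex : ∃ n, s ≤ t n := by
      obtain ⟨n, hn⟩ := (htT.eventually (lt_mem_nhds hs.2)).exists
      exact ⟨n, hn.le⟩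
    have hspec := Nat.find_spec hex
    rcases hk : Nat.find hex with _ | n
    · rw [hk, ht0] at hspec
      exact absurd hs.1 hspec.not_gt
    · rw [hk] at hspec
      exact mem_iUnion.2 ⟨n, not_le.1 (Nat.find_min hex (m := n) (by omega)), hspec⟩
  have hmeas : AEStronglyMeasurable p (volume.restrict (Ioc 0 T)) := by
    rw [← Measure.restrict_congr_set hUae]
    exact aestronglyMeasurable_iUnion_iff.2 fun n => (hmem n).1
  refine ⟨p, ?_, ?_, hp'⟩
  · rw [memLp_two_iff_integrable_sq hmeas]
    exact hU.congr_set_ae hUae.symm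
  · rw [intervalIntegral.integral_of_le (ht0 ▸ ht.ge_of_tendsto htT 0),
      ← setIntegral_congr_set hUae, integral_iUnion (fun n => measurableSet_Ioc) hdisj hU]
    exact hsum.tsum_le_tsum hint hbs

end Gluing

/-! ### One Newton step along the ground state -/

section LocalControl

variable {X : Type*} [NormedAddCommGroup X] [InnerProductSpace ℝ X]
  {P : ℝ → X →L[ℝ] X} {G : X →L[ℝ] X} {lam : ℝ} {e : X}

theorem SpectralResolution.exp_smul_proj (hP : SpectralResolution P) (he : P lam e = e)
    (t μ : ℝ) : Real.exp (-μ * t) • P μ e = Real.exp (-lam * t) • P μ e := by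
  by_cases h : μ = lam
  · rw [h]
  · rw [← he, hP.ortho _ _ _ h, smul_zero, smul_zero]

variable [CompleteSpace X]

/-- After scaling to `r = 1`, the linear null control cancels the first-order part of the deviation
from `e^{-λt} e`. What is left at time `τ` is a Duhamel term with both factors small: the control,
of size `e^{ν/τ} ε`, and the deviation, of the same order. -/
theorem exists_control_step (hP : SpectralResolution P) (hlam : 0 ≤ lam) (he : P lam e = e)
    {ν T₀ : ℝ} (hν : 0 < ν)
    (hcost : ∀ τ : ℝ, 0 < τ → τ ≤ T₀ → ∀ d : X, ∃ q : ℝ → ℝ,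
      MemLp q 2 (volume.restrict (Ioc 0 τ)) ∧
      ∫ s in (0 : ℝ)..τ, q s ^ 2 ≤ (2 * Real.exp (ν / τ) * ‖d‖) ^ 2 ∧
      ∀ μ, Real.exp (-μ * τ) • P μ d = duhamelTerm P (fun s => q s • G e) τ μ) :
    ∃ C₁ C₂ : ℝ, 0 < C₁ ∧ 0 ≤ C₂ ∧ ∀ τ : ℝ, 0 < τ → τ ≤ T₀ → τ ≤ 1 →
      ∀ ε : ℝ, 0 ≤ ε → ε ≤ 1 → 4 * (C₁ * (Real.exp (ν / τ) * ε)) * ‖G‖ ≤ 1 →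
      ∀ r : ℝ, 0 < r → ∀ h₀ : X, ‖h₀ - r • e‖ ≤ ε * r →
      ∃ (p : ℝ → ℝ) (h : ℝ → X), MemLp p 2 (volume.restrict (Ioc 0 τ)) ∧
        ∫ s in (0 : ℝ)..τ, p s ^ 2 ≤ (C₁ * (Real.exp (ν / τ) * ε)) ^ 2 ∧
        IsReducedSolution P G τ h₀ p h ∧
        ‖h τ - (r * Real.exp (-lam * τ)) • e‖ ≤
          C₂ * (Real.exp (ν / τ) * ε) ^ 2 * (r * Real.exp (-lam * τ)) := by
  -- The a priori bound doubles `‖k₀‖ ≤ ‖e‖ + ε ≤ ‖e‖ + 1`.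
  set M : ℝ := 2 * (‖e‖ + 1) with hM
  set C₁ : ℝ := 2 * Real.exp lam with hC₁
  refine ⟨C₁, 2 * C₁ * ‖G‖ * (1 + 2 * C₁ * ‖G‖ * M) * Real.exp lam, by positivity,
    by positivity, fun τ hτ hτT hτ1 ε hε hε1 hsmall r hr h₀ hh₀ => ?_⟩
  set a : ℝ := Real.exp (ν / τ) with ha
  have ha1 : 1 ≤ a := Real.one_le_exp (by positivity)
  set k₀ : X := r⁻¹ • h₀ with hk₀
  set d : X := k₀ - e with hd
  have hdε : ‖d‖ ≤ ε := by
    have : d = r⁻¹ • (h₀ - r • e) := by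
      rw [hd, hk₀, smul_sub, smul_smul, inv_mul_cancel₀ hr.ne', one_smul]
    rw [this, norm_smul, Real.norm_eq_abs, abs_of_pos (inv_pos.2 hr)]
    calc r⁻¹ * ‖h₀ - r • e‖ ≤ r⁻¹ * (ε * r) := by gcongr
      _ = ε := by field_simp
  obtain ⟨q, hq, hqn, hqd⟩ := hcost τ hτ hτT d
  set p : ℝ → ℝ := fun s => Real.exp (lam * s) * q s with hpdef
  have hq2 : IntervalIntegrable (fun s => q s ^ 2) volume 0 τ :=
    (intervalIntegrable_iff_integrableOn_Ioc_of_le hτ.le).2 hq.integrable_sq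
  have hexp : ∀ s ∈ Icc 0 τ, Real.exp (lam * s) ≤ Real.exp lam := fun s hs =>
    Real.exp_le_exp.2 (by nlinarith [hs.1, hs.2])
  have hpq : ∀ s ∈ Icc 0 τ, |p s| ≤ Real.exp lam * |q s| := fun s hs => by
    rw [hpdef, abs_mul, Real.abs_exp]
    exact mul_le_mul_of_nonneg_right (hexp s hs) (abs_nonneg _)
  have hp : MemLp p 2 (volume.restrict (Ioc 0 τ)) := by
    refine MemLp.of_le_mul (c := Real.exp lam) hq ?_ ?_
    · exact (by fun_prop : Continuous fun s => Real.exp (lam * s)).aestronglyMeasurable.mul hq.1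
    · exact (ae_restrict_iff' measurableSet_Ioc).2
        (Filter.Eventually.of_forall fun s hs => hpq s (Ioc_subset_Icc_self hs))
  have hp2 : IntervalIntegrable (fun s => p s ^ 2) volume 0 τ :=
    (intervalIntegrable_iff_integrableOn_Ioc_of_le hτ.le).2 hp.integrable_sq
  set η : ℝ := C₁ * (a * ε) with hη
  have hη0 : 0 ≤ η := by positivity
  have hpη : ∫ s in (0 : ℝ)..τ, p s ^ 2 ≤ η ^ 2 := by
    calc ∫ s in (0 : ℝ)..τ, p s ^ 2 ≤ ∫ s in (0 : ℝ)..τ, Real.exp lam ^ 2 * q s ^ 2 := by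
          refine intervalIntegral.integral_mono_on hτ.le hp2 (hq2.const_mul _) fun s hs => ?_
          rw [← sq_abs, ← sq_abs (q s), ← mul_pow]
          exact pow_le_pow_left₀ (abs_nonneg _) (hpq s hs) 2
      _ = Real.exp lam ^ 2 * ∫ s in (0 : ℝ)..τ, q s ^ 2 :=
          intervalIntegral.integral_const_mul _ _
      _ ≤ Real.exp lam ^ 2 * (2 * a * ‖d‖) ^ 2 := by gcongr
      _ ≤ Real.exp lam ^ 2 * (2 * a * ε) ^ 2 := by gcongr
      _ = η ^ 2 := by rw [hη, hC₁]; ring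
  have hτ3 : τ ≤ 3 := by linarith
  obtain ⟨k, hk⟩ := exists_isReducedSolution hP hp hη0 hpη hsmall hτ.le hτ3 k₀
  have hkM : ∀ t ∈ Icc 0 τ, ‖k t‖ ≤ M := fun t ht => by
    refine (hk.norm_le hP hp hη0 hpη hsmall hτ3 ht).trans ?_
    have : ‖k₀‖ ≤ ‖e‖ + ‖d‖ := by
      rw [show k₀ = e + d by rw [hd]; abel]; exact norm_add_le _ _
    linarith
  set D : ℝ → X := fun t => k t - Real.exp (-lam * t) • e with hD
  have hDc : ContinuousOn D (Icc 0 τ) :=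
    hk.continuousOn.sub (by fun_prop : Continuous fun t : ℝ =>
      Real.exp (-lam * t) • e).continuousOn
  have hDM : ∀ t ∈ Icc 0 τ, ‖D t‖ ≤ ε + 2 * η * ‖G‖ * M := by
    intro t ht
    have e1 : D t = spectralMul P (fun μ => Real.exp (-μ * t)) d -
        duhamel P (fun s => p s • G (k s)) t := by
      rw [hD]
      dsimp only
      rw [hk.apply_eq hP hp hτ3 ht, sub_right_comm]
      congr 1
      refine hP.ext fun μ => ?_
      rw [map_sub, hP.proj_spectralMul (abs_exp_neg_mul_le_one ht.1),
        hP.proj_spectralMul (abs_exp_neg_mul_le_one ht.1), hd, map_sub, (P μ).map_smul (Real.exp (-lam * t)),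
        smul_sub, hP.exp_smul_proj he]
    rw [e1]
    refine (norm_sub_le _ _).trans (add_le_add ?_ ?_)
    · refine (hP.norm_spectralMul_le (abs_exp_neg_mul_le_one ht.1) d).trans ?_
      rwa [one_mul]
    · exact norm_duhamel_control_le hP hp hη0 hpη hτ3 hk.continuousOn (by positivity) hkM ht
  have hττ : τ ∈ Icc 0 τ := ⟨hτ.le, le_rfl⟩
  -- The term `q G e` inside `p G k` exactly cancels the free evolution of `d` at time `τ`.
  have hDτ : D τ = - duhamel P (fun s => p s • G (D s)) τ := by
    have hmk := memLp_control_smul hp hk.continuousOn G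
    have hme := memLp_control_smul hq (continuousOn_const (c := e)) G
    refine hP.ext fun μ => ?_
    rw [map_neg, proj_duhamel hP (memLp_control_smul hp hDc G) hτ.le hτ3]
    have e2 : (fun s => p s • G (D s)) = fun s => p s • G (k s) - q s • G e := by
      funext s
      rw [hD, hpdef]
      simp only [map_sub, map_smul, smul_sub, smul_smul]
      rw [mul_right_comm, ← Real.exp_add, neg_mul, add_neg_cancel, Real.exp_zero, one_mul]
    rw [e2, duhamelTerm_sub hmk hme hτ.le, ← hqd μ, hD]
    dsimp only
    rw [map_sub, hk.proj_eq τ hττ, hd, map_sub, (P μ).map_smul (Real.exp (-lam * τ)), smul_sub,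
      hP.exp_smul_proj he]
    abel
  have hfin : ‖D τ‖ ≤ 2 * η * ‖G‖ * (ε + 2 * η * ‖G‖ * M) := by
    rw [hDτ, norm_neg]
    exact norm_duhamel_control_le hP hp hη0 hpη hτ3 hDc (by positivity) hDM hττ
  refine ⟨p, fun t => r • k t, hp, hpη, ?_, ?_⟩
  · have := hk.smul r
    rwa [hk₀, smul_smul, mul_inv_cancel₀ hr.ne', one_smul] at this
  · rw [mul_smul, ← smul_sub, norm_smul, Real.norm_eq_abs, abs_of_pos hr]
    change r * ‖D τ‖ ≤ _
    -- Since `τ ≤ 1`, a factor `e^λ` in the constant pays for measuring the error relative to the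
    -- decayed amplitude.
    have h1 : 1 ≤ Real.exp lam * Real.exp (-lam * τ) := by
      rw [← Real.exp_add]
      exact Real.one_le_exp (by nlinarith)
    have hεa : ε ≤ a * ε := by nlinarith
    calc r * ‖D τ‖ ≤ r * (2 * η * ‖G‖ * (ε + 2 * η * ‖G‖ * M)) := by gcongr
      _ ≤ r * (2 * η * ‖G‖ * (a * ε + 2 * η * ‖G‖ * M)) := by gcongr
      _ = r * (2 * η * ‖G‖ * (a * ε + 2 * η * ‖G‖ * M)) * 1 := by ring
      _ ≤ r * (2 * η * ‖G‖ * (a * ε + 2 * η * ‖G‖ * M)) *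
          (Real.exp lam * Real.exp (-lam * τ)) := by gcongr
      _ = _ := by rw [hη]; ring

end LocalControl

/-! ### Steering as a relation: scaling, composition, free evolution -/

section Steering

variable {X : Type*} [NormedAddCommGroup X] [InnerProductSpace ℝ X]

/-- Some control in `L²(0,T)` steers the reduced bilinear system from `h₀` to `h₁` in time `T`. -/
def CanSteer (P : ℝ → X →L[ℝ] X) (G : X →L[ℝ] X) (T : ℝ) (h₀ h₁ : X) : Prop :=
  ∃ (p : ℝ → ℝ) (h : ℝ → X), MemLp p 2 (volume.restrict (Ioc 0 T)) ∧
    IsReducedSolution P G T h₀ p h ∧ h T = h₁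

variable {P : ℝ → X →L[ℝ] X} {G : X →L[ℝ] X} {T T' : ℝ} {h₀ h₁ h₂ : X}

theorem CanSteer.smul (H : CanSteer P G T h₀ h₁) (c : ℝ) : CanSteer P G T (c • h₀) (c • h₁) := by
  obtain ⟨p, h, hp, hs, rfl⟩ := H
  exact ⟨p, fun t => c • h t, hp, hs.smul c, rfl⟩

theorem CanSteer.trans (hP : SpectralResolution P) (hT : 0 ≤ T) (hT' : 0 ≤ T')
    (H : CanSteer P G T h₀ h₁) (H' : CanSteer P G T' h₁ h₂) : CanSteer P G (T + T') h₀ h₂ := by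
  obtain ⟨p, h, hp, hs, rfl⟩ := H
  obtain ⟨p', h', hp', hs', rfl⟩ := H'
  let q : ℝ → ℝ := fun s => if s ≤ T then p s else p' (s - T)
  have q1 : ∀ s ∈ Ioc 0 T, q s = p s := fun s hs => if_pos hs.2
  have q2 : ∀ s ∈ Ioc T (T + T'), q s = p' (s - T) := fun s hs => if_neg hs.1.not_ge
  have q3 : ∀ s ∈ Ioc 0 T', q (T + s) = p' s := fun s hs => by
    rw [q2 _ ⟨by linarith [hs.1], by linarith [hs.2]⟩, add_sub_cancel_left]
  have hq : MemLp q 2 (volume.restrict (Ioc 0 (T + T'))) := by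
    rw [← Ioc_union_Ioc_eq_Ioc hT (by linarith : T ≤ T + T')]
    refine memLp_two_union (hp.ae_eq ?_) ((memLp_translate hp' T).ae_eq ?_)
    · exact (ae_restrict_iff' measurableSet_Ioc).2
        (Filter.Eventually.of_forall fun s hs => (q1 s hs).symm)
    · exact (ae_restrict_iff' measurableSet_Ioc).2
        (Filter.Eventually.of_forall fun s hs => (q2 s hs).symm)
  have hc := (hs.congr q1).concat hP hT hT' hq (hs'.congr q3)
  refine ⟨q, _, hq, hc, ?_⟩
  split_ifs with h1
  · have : T' = 0 := le_antisymm (by linarith) hT'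
    subst this
    rw [add_zero, hs'.apply_zero hP le_rfl]
  · rw [add_sub_cancel_left]

variable [CompleteSpace X]

theorem canSteer_free (hP : SpectralResolution P) (T : ℝ) (h₀ : X) :
    CanSteer P G T h₀ (spectralMul P (fun μ => Real.exp (-μ * T)) h₀) := by
  refine ⟨0, fun t => spectralMul P (fun μ => Real.exp (-μ * t)) h₀, MemLp.zero,
    ⟨continuousOn_spectralMul_exp hP h₀ T, fun t ht μ => ?_⟩, rfl⟩
  rw [hP.proj_spectralMul (abs_exp_neg_mul_le_one ht.1)]
  simp [duhamelTerm]

end Steering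

/-! ### Choice of the parameters of the iteration -/

section Iteration

/-- With `ε n = exp (-(N + κ)(3/2)^n)` the control size is a multiple of `exp (-N (3/2)^n)`. Its
square beats `ε (n + 1)` once `2N - C₂ ≥ (3/2)(N + κ)`, which is possible because `3/2 < 2`. -/
theorem exists_iteration_parameters {κ C₁ C₂ Γ : ℝ} (hκ : 0 ≤ κ) (hC₁ : 0 < C₁) (hC₂ : 0 ≤ C₂)
    (hΓ : 0 ≤ Γ) : ∃ (ε b : ℕ → ℝ) (η : ℝ), (∀ n, 0 < ε n) ∧ (∀ n, ε n ≤ 1) ∧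
      Filter.Tendsto ε Filter.atTop (nhds 0) ∧
      (∀ n, C₂ * (Real.exp (κ * (3 / 2) ^ n) * ε n) ^ 2 ≤ ε (n + 1)) ∧
      (∀ n, 4 * (C₁ * (Real.exp (κ * (3 / 2) ^ n) * ε n)) * Γ ≤ 1) ∧
      (∀ n, (C₁ * (Real.exp (κ * (3 / 2) ^ n) * ε n)) ^ 2 ≤ b n) ∧ Summable b ∧
      0 ≤ η ∧ ∑' n, b n ≤ η ^ 2 ∧ 4 * η * Γ ≤ 1 := by
  -- The terms `3κ + 2C₂` serve the quadratic recursion, `8C₁Γ` the smallness of single and total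
  -- controls through `e^N ≥ N + 1`, and `1` the geometric decay of `b`.
  set N : ℝ := 3 * κ + 2 * C₂ + 8 * C₁ * Γ + 1 with hN
  have hN1 : 1 ≤ N := by have : 0 ≤ C₁ * Γ := by positivity
                         linarith
  have hN0 : 0 ≤ N := by linarith
  have ha : ∀ n : ℕ, 1 + (n : ℝ) / 2 ≤ (3 / 2 : ℝ) ^ n := fun n => by
    have := one_add_mul_le_pow (show (-2 : ℝ) ≤ 1 / 2 by norm_num) n
    calc 1 + (n : ℝ) / 2 = 1 + n * (1 / 2) := by ring
      _ ≤ _ := this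
      _ = _ := by norm_num
  have ha1 : ∀ n : ℕ, 1 ≤ (3 / 2 : ℝ) ^ n := fun n => one_le_pow₀ (by norm_num)
  have hε : ∀ n : ℕ, Real.exp (κ * (3 / 2) ^ n) * Real.exp (-(N + κ) * (3 / 2) ^ n) =
      Real.exp (-N * (3 / 2) ^ n) := fun n => by
    rw [← Real.exp_add]; congr 1; ring
  have hinv : Real.exp (-N) * (8 * C₁ * Γ) ≤ 1 := by
    rw [Real.exp_neg, inv_mul_le_iff₀ (Real.exp_pos _), mul_one]
    have := Real.add_one_le_exp N
    linarith
  have hle : ∀ n : ℕ, Real.exp (-N * (3 / 2) ^ n) ≤ Real.exp (-N) := fun n =>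
    Real.exp_le_exp.2 (by nlinarith [ha1 n])
  refine ⟨fun n => Real.exp (-(N + κ) * (3 / 2) ^ n),
    fun n => (C₁ * Real.exp (-N)) ^ 2 * (1 / 2) ^ n, 2 * (C₁ * Real.exp (-N)),
    fun n => Real.exp_pos _, fun n => ?_, ?_, fun n => ?_, fun n => ?_, fun n => ?_, ?_,
    by positivity, ?_, ?_⟩
  · rw [Real.exp_le_one_iff]
    nlinarith [ha1 n]
  · refine Real.tendsto_exp_atBot.comp ?_
    refine (tendsto_pow_atTop_atTop_of_one_lt (by norm_num : (1 : ℝ) < 3 / 2)).const_mul_atTop_of_neg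
      (by linarith)
  · dsimp only
    rw [hε]
    have h1 : C₂ ≤ Real.exp (C₂ * (3 / 2) ^ n) := by
      have := Real.add_one_le_exp (C₂ * (3 / 2) ^ n)
      nlinarith [ha1 n]
    calc C₂ * Real.exp (-N * (3 / 2) ^ n) ^ 2
        ≤ Real.exp (C₂ * (3 / 2) ^ n) * Real.exp (-N * (3 / 2) ^ n) ^ 2 := by gcongr
      _ = Real.exp ((C₂ - 2 * N) * (3 / 2) ^ n) := by
          rw [← Real.exp_nat_mul, ← Real.exp_add]; congr 1; push_cast; ring
      _ ≤ Real.exp (-(N + κ) * (3 / 2) ^ (n + 1)) := by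
          refine Real.exp_le_exp.2 ?_
          rw [pow_succ]
          have : 0 ≤ C₁ * Γ := by positivity
          have h2 : C₂ - 2 * N ≤ -(N + κ) * (3 / 2) := by linarith
          nlinarith [ha1 n]
  · dsimp only
    rw [hε]
    calc 4 * (C₁ * Real.exp (-N * (3 / 2) ^ n)) * Γ ≤ 4 * (C₁ * Real.exp (-N)) * Γ := by
          have := hle n
          gcongr
      _ ≤ Real.exp (-N) * (8 * C₁ * Γ) := by
          have : 0 ≤ C₁ * Real.exp (-N) * Γ := by positivity
          nlinarith
      _ ≤ 1 := hinv
  · dsimp only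
    rw [hε, mul_pow, mul_pow, mul_assoc]
    gcongr
    have h2 : Real.exp (-1) ≤ 1 / 2 := by
      rw [Real.exp_neg, one_div]
      gcongr
      have := Real.add_one_le_exp (1 : ℝ)
      linarith
    -- Bernoulli's `(3/2)^n ≥ 1 + n/2` and `N ≥ 1` give `2N(3/2)^n ≥ 2N + n`.
    calc Real.exp (-N * (3 / 2) ^ n) ^ 2 ≤ Real.exp (-N) ^ 2 * Real.exp (-1) ^ n := by
          rw [← Real.exp_nat_mul, ← Real.exp_nat_mul, ← Real.exp_nat_mul, ← Real.exp_add]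
          refine Real.exp_le_exp.2 ?_
          push_cast
          have hn : (0 : ℝ) ≤ n := n.cast_nonneg
          nlinarith [mul_le_mul_of_nonneg_left (ha n) hN0]
      _ ≤ _ := by gcongr
  · exact (summable_geometric_of_lt_one (by norm_num) (by norm_num)).mul_left _
  · rw [tsum_mul_left, tsum_geometric_of_lt_one (by norm_num) (by norm_num)]
    nlinarith [sq_nonneg (C₁ * Real.exp (-N))]
  · calc 4 * (2 * (C₁ * Real.exp (-N))) * Γ = Real.exp (-N) * (8 * C₁ * Γ) := by ring
      _ ≤ 1 := hinv

end Iteration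

/-! ### Exact controllability near the ground state trajectory -/

section LocalControllability

variable {X : Type*} [NormedAddCommGroup X] [InnerProductSpace ℝ X] [CompleteSpace X]
  {P : ℝ → X →L[ℝ] X} {G : X →L[ℝ] X} {lam : ℝ} {e : X}

theorem exists_local_controllability (hP : SpectralResolution P) (hlam : 0 ≤ lam)
    (he : P lam e = e) {ν T₀ : ℝ} (hν : 0 < ν) (hT₀ : 0 < T₀)
    (hcost : ∀ τ : ℝ, 0 < τ → τ ≤ T₀ → ∀ d : X, ∃ q : ℝ → ℝ,
      MemLp q 2 (volume.restrict (Ioc 0 τ)) ∧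
      ∫ s in (0 : ℝ)..τ, q s ^ 2 ≤ (2 * Real.exp (ν / τ) * ‖d‖) ^ 2 ∧
      ∀ μ, Real.exp (-μ * τ) • P μ d = duhamelTerm P (fun s => q s • G e) τ μ) :
    ∃ δ T : ℝ, 0 < δ ∧ 0 < T ∧ ∀ r : ℝ, 0 < r → ∀ h₀ : X, ‖h₀ - r • e‖ ≤ δ * r →
      CanSteer P G T h₀ ((r * Real.exp (-lam * T)) • e) := by
  obtain ⟨C₁, C₂, hC₁, hC₂, hstep⟩ := exists_control_step (G := G) hP hlam he hν hcost
  set τ₀ : ℝ := min T₀ 1 with hτ₀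
  have hτ₀pos : 0 < τ₀ := lt_min hT₀ one_pos
  obtain ⟨ε, b, η, hε0, hε1, hεlim, hεsucc, hεsmall, hεb, hb, hη, hbη, hηG⟩ :=
    exists_iteration_parameters (κ := ν / τ₀) (by positivity) hC₁ hC₂ (norm_nonneg G)
  set τ : ℕ → ℝ := fun n => τ₀ * (2 / 3) ^ n with hτ
  have hτpos : ∀ n, 0 < τ n := fun n => by positivity
  have hτle : ∀ n, τ n ≤ τ₀ := fun n =>
    mul_le_of_le_one_right hτ₀pos.le (pow_le_one₀ (by norm_num) (by norm_num))
  have hντ : ∀ n, ν / τ n = ν / τ₀ * (3 / 2) ^ n := fun n => by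
    rw [hτ]
    dsimp only
    rw [div_mul_eq_div_div, div_eq_mul_inv _ ((2 / 3 : ℝ) ^ n), ← inv_pow]
    norm_num
  -- Partial sums of `τ`, with limit `3τ₀`.
  set t : ℕ → ℝ := fun n => 3 * τ₀ * (1 - (2 / 3) ^ n) with ht
  have ht0 : t 0 = 0 := by simp [ht]
  have htsucc : ∀ n, t (n + 1) = t n + τ n := fun n => by simp only [ht, hτ, pow_succ]; ring
  have htmono : Monotone t := monotone_nat_of_le_succ fun n => by
    rw [htsucc]; linarith [hτpos n]
  have htnn : ∀ n, 0 ≤ t n := fun n => ht0 ▸ htmono n.zero_le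
  have htlim : Filter.Tendsto t Filter.atTop (nhds (3 * τ₀)) := by
    have h := ((tendsto_pow_atTop_nhds_zero_of_lt_one (by norm_num : (0 : ℝ) ≤ 2 / 3)
      (by norm_num)).const_sub 1).const_mul (3 * τ₀)
    simpa using h
  have htle : ∀ n, t n ≤ 3 * τ₀ := fun n => htmono.ge_of_tendsto htlim n
  have hT3 : 3 * τ₀ ≤ 3 := by linarith [min_le_right T₀ 1]
  refine ⟨ε 0, 3 * τ₀, hε0 0, by positivity, fun r hr h₀ hh₀ => ?_⟩
  set ρ : ℕ → ℝ := fun n => r * Real.exp (-lam * t n) with hρ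
  have hρpos : ∀ n, 0 < ρ n := fun n => by positivity
  have hρsucc : ∀ n, ρ (n + 1) = ρ n * Real.exp (-lam * τ n) := fun n => by
    simp only [hρ]
    rw [htsucc, mul_assoc, ← Real.exp_add]
    congr 2; ring
  -- The closeness condition sits inside the existential so that `choose` yields functions of every
  -- `x`, from which the states can be defined by recursion.
  have hnext : ∀ (n : ℕ) (x : X), ∃ (p : ℝ → ℝ) (h : ℝ → X), ‖x - ρ n • e‖ ≤ ε n * ρ n →
      MemLp p 2 (volume.restrict (Ioc 0 (τ n))) ∧ ∫ s in (0 : ℝ)..τ n, p s ^ 2 ≤ b n ∧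
      IsReducedSolution P G (τ n) x p h ∧
      ‖h (τ n) - ρ (n + 1) • e‖ ≤ ε (n + 1) * ρ (n + 1) := by
    intro n x
    by_cases hx : ‖x - ρ n • e‖ ≤ ε n * ρ n
    · obtain ⟨p, h, h1, h2, h3, h4⟩ := hstep (τ n) (hτpos n) ((hτle n).trans (min_le_left _ _))
        ((hτle n).trans (min_le_right _ _)) (ε n) (hε0 n).le (hε1 n)
        (by rw [hντ]; exact hεsmall n) (ρ n) (hρpos n) x hx
      rw [hντ] at h2 h4
      refine ⟨p, h, fun _ => ⟨h1, h2.trans (hεb n), h3, ?_⟩⟩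
      rw [hρsucc]
      exact h4.trans (mul_le_mul_of_nonneg_right (hεsucc n) (hρsucc n ▸ (hρpos (n + 1)).le))
    · exact ⟨0, 0, fun h => absurd h hx⟩
  choose pf hf hpf using hnext
  let st : ℕ → X := fun n => Nat.rec h₀ (fun n x => hf n x (τ n)) n
  have hst : ∀ n, st (n + 1) = hf n (st n) (τ n) := fun n => rfl
  have hinv : ∀ n, ‖st n - ρ n • e‖ ≤ ε n * ρ n := by
    intro n
    induction n with
    | zero =>
      change ‖h₀ - ρ 0 • e‖ ≤ _
      simpa [hρ, ht0] using hh₀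
    | succ n ih => rw [hst]; exact (hpf n (st n) ih).2.2.2
  have hdiff : ∀ n, t (n + 1) - t n = τ n := fun n => by rw [htsucc, add_sub_cancel_left]
  obtain ⟨p, hp, hpb, hpq⟩ := exists_glued_control htmono ht0 htlim
    (q := fun n => pf n (st n)) (b := b) (fun n => by rw [hdiff]; exact (hpf n _ (hinv n)).1)
    (fun n => by rw [hdiff]; exact (hpf n _ (hinv n)).2.1) hb
  have hpη : ∫ s in (0 : ℝ)..(3 * τ₀), p s ^ 2 ≤ η ^ 2 := hpb.trans hbη
  -- The concatenated pieces say nothing at the limit time. The glued control is small enough to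
  -- have a solution up to and including `3τ₀`; uniqueness identifies it with the pieces at each `t
  -- n`, and continuity gives its final value.
  obtain ⟨k, hk⟩ := exists_isReducedSolution hP hp hη hpη hηG (by positivity) hT3 h₀
  have hpn : ∀ n, MemLp p 2 (volume.restrict (Ioc 0 (t n))) := fun n => memLp_mono_Ioc hp (htle n)
  have hpnη : ∀ n, ∫ s in (0 : ℝ)..t n, p s ^ 2 ≤ η ^ 2 := fun n =>
    (intervalIntegral.integral_mono_interval le_rfl (htnn n) (htle n)
      (Filter.Eventually.of_forall fun s => sq_nonneg _)
      ((intervalIntegrable_iff_integrableOn_Ioc_of_le (by positivity)).2 hp.integrable_sq)).trans hpη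
  have hpieces : ∀ n, ∃ h, IsReducedSolution P G (t n) h₀ p h ∧ h (t n) = st n := by
    intro n
    induction n with
    | zero =>
      have h0 := hk.mono (T' := t 0) (htle 0)
      refine ⟨k, h0, ?_⟩
      conv_lhs => rw [ht0]
      exact h0.apply_zero hP (htnn 0)
    | succ n ih =>
      obtain ⟨h, hh, hhn⟩ := ih
      have h' := (hpf n _ (hinv n)).2.2.1
      have h2 : IsReducedSolution P G (τ n) (h (t n)) (fun s => p (t n + s)) (hf n (st n)) := by
        rw [hhn]
        exact h'.congr fun s hs => hpq n s (by rwa [hdiff])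
      have h3 := hh.concat hP (htnn n) (hτpos n).le (by rw [← htsucc]; exact hpn (n + 1)) h2
      refine ⟨_, by rw [htsucc]; exact h3, ?_⟩
      have h4 : ¬ t n + τ n ≤ t n := by linarith [hτpos n]
      rw [htsucc, hst]
      rw [if_neg h4, add_sub_cancel_left]
  have hkst : ∀ n, k (t n) = st n := by
    intro n
    obtain ⟨h, hh, hhn⟩ := hpieces n
    rw [← hhn]
    exact (hk.mono (htle n)).unique hP (hpn n) hη (hpnη n) hηG ((htle n).trans hT3) hh
      ⟨htnn n, le_rfl⟩
  refine ⟨p, k, hp, hk, ?_⟩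
  have hlim1 : Filter.Tendsto (fun n => k (t n)) Filter.atTop (nhds (k (3 * τ₀))) := by
    have hmem : (3 * τ₀) ∈ Icc 0 (3 * τ₀) := ⟨by positivity, le_rfl⟩
    refine (hk.continuousOn _ hmem).tendsto.comp (tendsto_nhdsWithin_iff.2 ⟨htlim, ?_⟩)
    exact Filter.Eventually.of_forall fun n => ⟨htnn n, htle n⟩
  have hρlim : Filter.Tendsto ρ Filter.atTop (nhds (r * Real.exp (-lam * (3 * τ₀)))) :=
    ((Real.continuous_exp.tendsto _).comp (htlim.const_mul (-lam))).const_mul r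
  have hlim2 : Filter.Tendsto (fun n => k (t n) - ρ n • e) Filter.atTop (nhds 0) := by
    refine squeeze_zero_norm (a := fun n => ε n * ρ n) (fun n => by rw [hkst]; exact hinv n) ?_
    simpa using hεlim.mul hρlim
  have hlim3 := hlim2.add (hρlim.smul_const e)
  simp only [sub_add_cancel, zero_add] at hlim3
  exact tendsto_nhds_unique hlim1 hlim3

end LocalControllability

/-! ### From a neighbourhood of the ground state to the cone of size `R` -/

section GlobalControllability

variable {X : Type*} [NormedAddCommGroup X] [InnerProductSpace ℝ X] [CompleteSpace X]
  {P : ℝ → X →L[ℝ] X} {G : X →L[ℝ] X} {lam : ℝ} {e : X}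

/-- The `lam`-component cancels exactly and every other nonzero component decays at least at rate
`lam + g`. Since `e` has no components off `lam`, `h₀` may be replaced there by `h₀ - e`. -/
theorem norm_spectralMul_exp_sub_le (hP : SpectralResolution P) (he : P lam e = e) {g r₀ t : ℝ}
    (hgap : ∀ μ x, μ ≠ lam → μ < lam + g → P μ x = 0) (ht : 0 ≤ t) {h₀ : X}
    (hproj : P lam h₀ = r₀ • e) :
    ‖spectralMul P (fun μ => Real.exp (-μ * t)) h₀ - (r₀ * Real.exp (-lam * t)) • e‖ ≤
      Real.exp (-(lam + g) * t) * ‖h₀ - e‖ := by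
  refine hP.norm_le_of_proj_le (Real.exp_nonneg _) fun μ => ?_
  rw [map_sub, hP.proj_spectralMul (abs_exp_neg_mul_le_one ht), map_smul]
  by_cases hμ : μ = lam
  · subst hμ
    rw [hproj, he, smul_smul, mul_comm, sub_self, norm_zero]
    positivity
  · have h0 : P μ e = 0 := by rw [← he, hP.ortho _ _ _ hμ]
    rw [h0, smul_zero, sub_zero, map_sub, h0, sub_zero, norm_smul, Real.norm_eq_abs, Real.abs_exp]
    rcases lt_or_ge μ (lam + g) with h | h
    · simp [hgap μ _ hμ h]
    · gcongr

/-- A point `s • e` lies within the local radius of `(ρ s) • e` when `ρ - 1` is small, so each local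
step gains a factor `ρ` in amplitude over free decay. -/
theorem canSteer_chain (hP : SpectralResolution P) {δ T ρ : ℝ} (hT : 0 < T)
    (hloc : ∀ r : ℝ, 0 < r → ∀ h₀ : X, ‖h₀ - r • e‖ ≤ δ * r →
      CanSteer P G T h₀ ((r * Real.exp (-lam * T)) • e))
    (hρ : 1 ≤ ρ) (hδ : (ρ - 1) * ‖e‖ ≤ δ) (m : ℕ) {r : ℝ} (hr : 0 < r) :
    CanSteer P G (m * T) (r • e) ((r * ρ ^ m * Real.exp (-lam * (m * T))) • e) := by
  have hδ0 : 0 ≤ δ := le_trans (mul_nonneg (by linarith) (norm_nonneg e)) hδ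
  induction m with
  | zero =>
    have h := canSteer_free (G := G) hP 0 (r • e)
    have h0 : spectralMul P (fun μ => Real.exp (-μ * 0)) (r • e) = r • e := by
      simpa [spectralMul] using (hP.hasSum (r • e)).tsum_eq
    rw [h0] at h
    simpa using h
  | succ m ih =>
    set s : ℝ := r * ρ ^ m * Real.exp (-lam * (m * T)) with hs
    have hs0 : 0 < s := by positivity
    have h1 := hloc (ρ * s) (by positivity) (s • e) (by
      rw [← sub_smul, norm_smul, Real.norm_eq_abs, abs_of_nonpos (by nlinarith)]
      calc -(s - ρ * s) * ‖e‖ = s * ((ρ - 1) * ‖e‖) := by ring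
        _ ≤ s * δ := by gcongr
        _ ≤ δ * (ρ * s) := by nlinarith [mul_nonneg hδ0 hs0.le])
    have h2 := ih.trans hP (by positivity) hT.le h1
    have e1 : ((m + 1 : ℕ) : ℝ) * T = m * T + T := by push_cast; ring
    rw [e1]
    convert h2 using 2
    rw [hs, mul_add, Real.exp_add, pow_succ]
    ring

/-- The projection of `h₀` is smaller than the desired `e` by the factor `1 + lam`. The time is
spent on free decay (`T₁`), one local step (`T`) and `m` amplifying steps restoring this factor. -/
theorem exists_canSteer_ground (hP : SpectralResolution P) (hlam : 0 ≤ lam) (he : P lam e = e)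
    {g : ℝ} (hg : 0 < g) (hgap : ∀ μ x, μ ≠ lam → μ < lam + g → P μ x = 0)
    {δ T : ℝ} (hδ : 0 < δ) (hT : 0 < T)
    (hloc : ∀ r : ℝ, 0 < r → ∀ h₀ : X, ‖h₀ - r • e‖ ≤ δ * r →
      CanSteer P G T h₀ ((r * Real.exp (-lam * T)) • e)) {R : ℝ} (hR : 0 < R) :
    ∃ T' : ℝ, 0 < T' ∧ ∀ h₀ : X, ‖h₀ - e‖ ≤ R → P lam h₀ = (1 + lam)⁻¹ • e →
      CanSteer P G T' h₀ (Real.exp (-lam * T') • e) := by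
  set r₀ : ℝ := (1 + lam)⁻¹ with hr₀
  have hr₀pos : 0 < r₀ := by positivity
  -- Chosen so that `e^{gT₁} ≥ gT₁ = R/(δ r₀)`.
  set T₁ : ℝ := R / (δ * r₀ * g) with hT₁
  have hT₁pos : 0 < T₁ := by positivity
  have hdecay : Real.exp (-g * T₁) * R ≤ δ * r₀ := by
    have h1 : g * T₁ = R / (δ * r₀) := by rw [hT₁]; field_simp
    have h2 := Real.add_one_le_exp (g * T₁)
    rw [neg_mul, Real.exp_neg, inv_mul_le_iff₀ (Real.exp_pos _)]
    have h3 : R = g * T₁ * (δ * r₀) := by rw [h1]; field_simp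
    have : 0 < δ * r₀ := by positivity
    nlinarith
  have hm : ∃ m : ℕ, m ≠ 0 ∧ (Real.exp (Real.log (1 + lam) / m) - 1) * ‖e‖ ≤ δ := by
    have h1 : Filter.Tendsto (fun m : ℕ => (Real.exp (Real.log (1 + lam) / m) - 1) * ‖e‖)
        Filter.atTop (nhds ((Real.exp 0 - 1) * ‖e‖)) :=
      (((Real.continuous_exp.tendsto 0).comp
        (tendsto_const_div_atTop_nhds_zero_nat _)).sub_const 1).mul_const _
    rw [Real.exp_zero, sub_self, zero_mul] at h1
    exact ((Filter.eventually_ne_atTop 0).and ((h1.eventually (gt_mem_nhds hδ)).mono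
      fun _ h => h.le)).exists
  obtain ⟨m, hm0, hmδ⟩ := hm
  set ρ : ℝ := Real.exp (Real.log (1 + lam) / m) with hρ
  have hρ1 : 1 ≤ ρ := Real.one_le_exp (div_nonneg (Real.log_nonneg (by linarith)) m.cast_nonneg)
  have hρm : ρ ^ m = 1 + lam := by
    have : (m : ℝ) ≠ 0 := Nat.cast_ne_zero.2 hm0
    rw [hρ, ← Real.exp_nat_mul, mul_div_cancel₀ _ this, Real.exp_log (by linarith)]
  refine ⟨T₁ + T + m * T, by positivity, fun h₀ hh₀ hproj => ?_⟩
  have s1 := canSteer_free (G := G) hP T₁ h₀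
  have s2 := hloc (r₀ * Real.exp (-lam * T₁)) (by positivity)
    (spectralMul P (fun μ => Real.exp (-μ * T₁)) h₀) (by
      refine (norm_spectralMul_exp_sub_le hP he hgap hT₁pos.le hproj).trans ?_
      calc Real.exp (-(lam + g) * T₁) * ‖h₀ - e‖ ≤ Real.exp (-(lam + g) * T₁) * R := by gcongr
        _ = Real.exp (-lam * T₁) * (Real.exp (-g * T₁) * R) := by
          rw [← mul_assoc, ← Real.exp_add]; congr 2; ring
        _ ≤ Real.exp (-lam * T₁) * (δ * r₀) := by gcongr
        _ = _ := by ring)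
  have s3 := canSteer_chain hP hT hloc hρ1 hmδ m
    (r := r₀ * Real.exp (-lam * T₁) * Real.exp (-lam * T)) (by positivity)
  have s4 := (s1.trans hP hT₁pos.le hT.le s2).trans hP (by positivity) (by positivity) s3
  convert s4 using 2
  have : r₀ * (1 + lam) = 1 := by rw [hr₀]; field_simp
  rw [hρm]
  calc Real.exp (-lam * (T₁ + T + m * T))
      = Real.exp (-lam * T₁) * Real.exp (-lam * T) * Real.exp (-lam * (m * T)) := by
        rw [← Real.exp_add, ← Real.exp_add]; congr 1; ring
    _ = (r₀ * (1 + lam)) *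
        (Real.exp (-lam * T₁) * Real.exp (-lam * T) * Real.exp (-lam * (m * T))) := by
        rw [this, one_mul]
    _ = _ := by ring

/-- Null controllability with one scalar control forces the ground state to be simple. -/
theorem exists_proj_eq_smul (he : P lam e = e) (he0 : e ≠ 0) {τ : ℝ}
    (hnull : ∀ d : X, ∃ q : ℝ → ℝ, MemLp q 2 (volume.restrict (Ioc 0 τ)) ∧
      ∀ μ, Real.exp (-μ * τ) • P μ d = duhamelTerm P (fun s => q s • G e) τ μ) (x : X) :
    ∃ c : ℝ, P lam x = c • e := by
  -- The scalar control acts on the component `lam` only along `P lam (G e)`, so every projection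
  -- lies on this line; `e` itself does, hence spans it.
  have h1 : ∀ d, ∃ c : ℝ, P lam d = c • P lam (G e) := by
    intro d
    obtain ⟨q, -, hq⟩ := hnull d
    refine ⟨(Real.exp (-lam * τ))⁻¹ *
      (√(1 + lam) * ∫ s in (0 : ℝ)..τ, Real.exp (-lam * (τ - s)) * q s), ?_⟩
    have h2 := hq lam
    simp only [duhamelTerm, map_smul, smul_smul] at h2
    rw [intervalIntegral.integral_smul_const, smul_smul] at h2
    rw [mul_smul, ← h2, smul_smul, inv_mul_cancel₀ (Real.exp_pos _).ne', one_smul]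
  obtain ⟨c₀, hc₀⟩ := h1 e
  obtain ⟨c, hc⟩ := h1 x
  rw [he] at hc₀
  have hc0 : c₀ ≠ 0 := fun h => he0 (by rw [hc₀, h, zero_smul])
  refine ⟨c * c₀⁻¹, ?_⟩
  rw [hc, mul_smul]
  congr 1
  rw [eq_inv_smul_iff₀ hc0]
  exact hc₀.symm

end GlobalControllability

/-! ### Spectral resolution and spectral gap from the compact resolvent -/

section Spectrum

variable {X : Type*} [NormedAddCommGroup X] [InnerProductSpace ℝ X] [CompleteSpace X]
  {A : X →ₗ.[ℝ] X} {μ ν lam : ℝ} {x y : X}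

theorem IsAdmissible.inner_left (hA : IsAdmissible A) (x y : A.domain) :
    inner ℝ (A x) (y : X) = inner ℝ (x : X) (A y) := by
  have h := LinearPMap.adjoint_isFormalAdjoint hA.dense
  rw [LinearPMap.isSelfAdjoint_def.1 hA.selfAdjoint] at h
  exact h x y

theorem IsAdmissible.inner_eigenspace (hA : IsAdmissible A) (hμν : μ ≠ ν)
    (hx : x ∈ eigenspace A μ) (hy : y ∈ eigenspace A ν) : inner ℝ x y = 0 := by
  obtain ⟨hx, ex⟩ := hx
  obtain ⟨hy, ey⟩ := hy
  have h := hA.inner_left ⟨x, hx⟩ ⟨y, hy⟩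
  rw [ex, ey, real_inner_smul_left, real_inner_smul_right] at h
  have h2 : (μ - ν) * inner ℝ x y = 0 := by rw [sub_mul, h, sub_self]
  exact (mul_eq_zero.1 h2).resolve_left (sub_ne_zero.2 hμν)

theorem IsAdmissible.nonneg_of_mem_eigenspace (hA : IsAdmissible A) (hx : x ∈ eigenspace A μ)
    (hx0 : x ≠ 0) : 0 ≤ μ := by
  obtain ⟨hx, ex⟩ := hx
  have h := hA.nonneg ⟨x, hx⟩
  rw [ex, real_inner_smul_left, real_inner_self_eq_norm_sq] at h
  have : 0 < ‖x‖ ^ 2 := by positivity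
  by_contra! hμ
  nlinarith

/-- The resolvent `K` is compact and symmetric, so its eigenvectors are total; an eigenvalue `κ ≠ 0`
of `K` gives the eigenvalue `κ⁻¹ - c` of `A`. -/
theorem IsAdmissible.iSup_eigenspace_orthogonal (hA : IsAdmissible A) :
    (⨆ μ, eigenspace A μ)ᗮ = ⊥ := by
  obtain ⟨c, hc, K, hK, h1, h2⟩ := hA.compactResolvent
  have hsymm : K.IsSymmetric := by
    intro x y
    obtain ⟨hx, ex⟩ := h1 x
    obtain ⟨hy, ey⟩ := h1 y
    have h := hA.inner_left ⟨K x, hx⟩ ⟨K y, hy⟩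
    change inner ℝ (K x) y = inner ℝ x (K y)
    conv_lhs => rw [← ey]
    conv_rhs => rw [← ex]
    rw [inner_add_left, inner_add_right, real_inner_smul_left, real_inner_smul_right, h]
  have hle : (⨆ κ, Module.End.eigenspace (K : Module.End ℝ X) κ) ≤ ⨆ μ, eigenspace A μ := by
    refine iSup_le fun κ x hx => ?_
    have hKx : K x = κ • x := Module.End.mem_eigenspace_iff.1 hx
    obtain ⟨hd, ex⟩ := h1 x
    by_cases hκ : κ = 0
    · have h0 : K x = 0 := by rw [hKx, hκ, zero_smul]
      have h3 : (⟨K x, hd⟩ : A.domain) = 0 := Subtype.ext h0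
      rw [h3, h0, A.map_zero, smul_zero, add_zero] at ex
      rw [← ex]
      exact zero_mem _
    · have hxd : x ∈ A.domain := by
        have := A.domain.smul_mem κ⁻¹ hd
        rwa [hKx, smul_smul, inv_mul_cancel₀ hκ, one_smul] at this
      refine Submodule.mem_iSup_of_mem (κ⁻¹ - c) ⟨hxd, ?_⟩
      have h3 : (⟨K x, hd⟩ : A.domain) = κ • ⟨x, hxd⟩ := Subtype.ext hKx
      rw [h3, A.map_smul, hKx] at ex
      have h4 : κ • A ⟨x, hxd⟩ = x - c • κ • x := eq_sub_of_add_eq' ex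
      rw [← inv_smul_smul₀ hκ (A ⟨x, hxd⟩), h4, smul_sub, sub_smul, smul_comm c κ,
        inv_smul_smul₀ hκ]
  exact eq_bot_iff.2 ((Submodule.orthogonal_le hle).trans
    (ContinuousLinearMap.orthogonalComplement_iSup_eigenspaces_eq_bot hK hsymm).le)

theorem IsAdmissible.inner_closure (hA : IsAdmissible A) (hμν : μ ≠ ν)
    (hx : x ∈ (eigenspace A μ).topologicalClosure)
    (hy : y ∈ (eigenspace A ν).topologicalClosure) : inner ℝ x y = 0 := by
  have h1 : (eigenspace A μ).topologicalClosure ⟂ (eigenspace A ν).topologicalClosure := by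
    rw [Submodule.isOrtho_iff_le, Submodule.orthogonal_closure]
    refine Submodule.topologicalClosure_minimal _ ?_ (Submodule.isClosed_orthogonal _)
    exact Submodule.isOrtho_iff_inner_eq.2 fun x hx y hy => hA.inner_eigenspace hμν hx hy
  exact Submodule.isOrtho_iff_inner_eq.1 h1 x hx y hy

theorem eigenproj_mem (A : X →ₗ.[ℝ] X) (μ : ℝ) (x : X) :
    eigenproj A μ x ∈ (eigenspace A μ).topologicalClosure :=
  Submodule.starProjection_apply_mem _ x

theorem eigenproj_eq_self (hx : x ∈ eigenspace A μ) : eigenproj A μ x = x :=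
  Submodule.starProjection_eq_self_iff.2 (Submodule.le_topologicalClosure _ hx)

theorem eigenproj_eq_zero (h : eigenspace A μ = ⊥) (x : X) : eigenproj A μ x = 0 := by
  have h1 := eigenproj_mem A μ x
  rw [h] at h1
  have h2 : (⊥ : Submodule ℝ X).topologicalClosure = ⊥ :=
    IsClosed.submodule_topologicalClosure_eq (by simp)
  rw [h2] at h1
  exact (Submodule.mem_bot ℝ).1 h1

theorem IsAdmissible.spectralResolution (hA : IsAdmissible A) :
    SpectralResolution (eigenproj A) := by
  have hortho : ∀ μ ν x, μ ≠ ν → eigenproj A μ (eigenproj A ν x) = 0 := fun μ ν x h =>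
    (Submodule.starProjection_apply_eq_zero_iff _).2 fun y hy =>
      hA.inner_closure h hy (eigenproj_mem A ν x)
  have hself : ∀ μ x, x ∈ (eigenspace A μ).topologicalClosure → eigenproj A μ x = x :=
    fun μ x h => Submodule.starProjection_eq_self_iff.2 h
  refine ⟨fun μ x y => Submodule.inner_starProjection_left_eq_right _ x y,
    fun μ x => hself μ _ (eigenproj_mem A μ x), hortho, fun μ x hμ => eigenproj_eq_zero ?_ x,
    fun x => ?_⟩
  · refine (Submodule.eq_bot_iff _).2 fun y hy => ?_
    by_contra h
    exact absurd (hA.nonneg_of_mem_eigenspace hy h) (not_le.2 hμ)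
  · have hfam : OrthogonalFamily ℝ (fun μ => (eigenspace A μ).topologicalClosure)
        fun μ => ((eigenspace A μ).topologicalClosure).subtypeₗᵢ := by
      rintro μ ν h ⟨x, hx⟩ ⟨y, hy⟩
      exact hA.inner_closure h hx hy
    have htot : ⊤ ≤ (⨆ μ, (eigenspace A μ).topologicalClosure).topologicalClosure := by
      rw [top_le_iff, Submodule.topologicalClosure_eq_top_iff, eq_bot_iff,
        ← hA.iSup_eigenspace_orthogonal]
      exact Submodule.orthogonal_le (iSup_mono fun μ => Submodule.le_topologicalClosure _)
    have hH := IsHilbertSum.mkInternal _ hfam htot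
    have hs := hH.hasSum_linearIsometryEquiv_symm (hH.linearIsometryEquiv x)
    rw [LinearIsometryEquiv.symm_apply_apply] at hs
    refine hs.congr_fun fun μ => ?_
    have h1 := hs.map (eigenproj A μ) (eigenproj A μ).continuous
    refine h1.unique ?_
    convert hasSum_single μ ?_ using 1
    · exact (hself μ _ (Subtype.coe_prop _)).symm
    · intro ν hν
      simp only [Function.comp_apply, Submodule.coe_subtypeₗᵢ, Submodule.subtype_apply]
      rw [← hself ν _ (Subtype.coe_prop _), hortho _ _ _ hν.symm]

/-- Otherwise there are unit eigenvectors with eigenvalues decreasing to `lam`. As `x n = (c + μ n)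
• K (x n)`, compactness gives a convergent subsequence, whose limit is a unit eigenvector for `lam`
orthogonal to all the `x n`: a contradiction. -/
theorem IsAdmissible.exists_spectral_gap (hA : IsAdmissible A) (lam : ℝ) :
    ∃ g : ℝ, 0 < g ∧ ∀ μ, lam < μ → μ < lam + g → eigenspace A μ = ⊥ := by
  by_contra! hcon
  obtain ⟨c, hc, K, hK, h1, h2⟩ := hA.compactResolvent
  have hex : ∀ n : ℕ, ∃ (μ : ℝ) (x : X), lam < μ ∧ μ < lam + 1 / ((n : ℝ) + 1) ∧
      x ∈ eigenspace A μ ∧ ‖x‖ = 1 := by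
    intro n
    obtain ⟨μ, hμ1, hμ2, hμ3⟩ := hcon (1 / ((n : ℝ) + 1)) (by positivity)
    obtain ⟨x, hx, hx0⟩ := Submodule.exists_mem_ne_zero_of_ne_bot hμ3
    refine ⟨μ, ‖x‖⁻¹ • x, hμ1, hμ2, Submodule.smul_mem _ _ hx, ?_⟩
    rw [norm_smul, norm_inv, norm_norm, inv_mul_cancel₀ (norm_ne_zero_iff.2 hx0)]
  choose μ x hμ1 hμ2 hx hx1 using hex
  have hμlim : Filter.Tendsto μ Filter.atTop (nhds lam) := by
    refine tendsto_of_tendsto_of_tendsto_of_le_of_le tendsto_const_nhds ?_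
      (fun n => (hμ1 n).le) (fun n => (hμ2 n).le)
    simpa using (tendsto_one_div_add_atTop_nhds_zero_nat (𝕜 := ℝ)).const_add lam
  have hKx : ∀ n, x n = (c + μ n) • K (x n) := by
    intro n
    obtain ⟨hd, ex⟩ := hx n
    have h := h2 ⟨x n, hd⟩
    rw [ex, ← add_smul, map_smul] at h
    exact h.symm
  obtain ⟨C, hC, hKC⟩ :=
    IsCompactOperator.image_closedBall_subset_compact (𝕜₁ := ℝ) (f := K.toLinearMap) hK 1
  obtain ⟨z, -, φ, hφ, hz⟩ := hC.tendsto_subseq fun n => hKC ⟨x n, by simp [hx1], rfl⟩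
  have hxlim : Filter.Tendsto (fun n => x (φ n)) Filter.atTop (nhds ((c + lam) • z)) := by
    have h := ((hμlim.comp hφ.tendsto_atTop).const_add c).smul hz
    refine h.congr fun n => ?_
    exact (hKx (φ n)).symm
  set y : X := (c + lam) • z with hy
  have hy1 : ‖y‖ = 1 := by
    refine tendsto_nhds_unique hxlim.norm ?_
    simp [hx1]
  have hKy : K y = z := tendsto_nhds_unique ((K.continuous.tendsto y).comp hxlim) hz
  obtain ⟨hd, ey⟩ := h1 y
  have hmem : K y ∈ eigenspace A lam := by
    refine ⟨hd, ?_⟩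
    rw [eq_sub_of_add_eq' ey, sub_eq_iff_eq_add, ← add_smul, hKy, add_comm lam]
  have hyE : y ∈ eigenspace A lam := by
    rw [hy, ← hKy]
    exact Submodule.smul_mem _ _ hmem
  have h0 : inner ℝ y y = 0 := by
    refine tendsto_nhds_unique (hxlim.inner (tendsto_const_nhds (x := y))) ?_
    refine tendsto_const_nhds.congr fun n => ?_
    exact (hA.inner_eigenspace (hμ1 (φ n)).ne' (hx _) hyE).symm
  rw [real_inner_self_eq_norm_sq, hy1] at h0
  norm_num at h0

end Spectrum

/-! ### Passage between `D(A^{1/2})` and the reduced system -/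

section Energy

variable {X : Type*} [NormedAddCommGroup X] [InnerProductSpace ℝ X] [CompleteSpace X]
  {P : ℝ → X →L[ℝ] X}

theorem abs_inv_sqrt_one_add_le_one (μ : ℝ) (hμ : 0 ≤ μ) : |(√(1 + μ))⁻¹| ≤ 1 := by
  rw [abs_of_nonneg (by positivity)]
  exact inv_le_one_of_one_le₀ (Real.one_le_sqrt.2 (by linarith))

namespace SpectralResolution

/-- The isometry `(1 + A)^{-1/2}` of `X` onto `D(A^{1/2})`. -/
noncomputable def energyMap (hP : SpectralResolution P) : X →L[ℝ] X :=
  hP.mulCLM (fun μ => (√(1 + μ))⁻¹) 1 abs_inv_sqrt_one_add_le_one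

theorem proj_energyMap (hP : SpectralResolution P) (h : X) (μ : ℝ) :
    P μ (hP.energyMap h) = (√(1 + μ))⁻¹ • P μ h :=
  hP.proj_spectralMul abs_inv_sqrt_one_add_le_one h μ

theorem sqrt_smul_proj_energyMap (hP : SpectralResolution P) (h : X) (μ : ℝ) :
    √(1 + μ) • P μ (hP.energyMap h) = P μ h := by
  rcases lt_or_ge μ 0 with hμ | hμ
  · rw [hP.neg μ _ hμ, hP.neg μ _ hμ, smul_zero]
  · rw [hP.proj_energyMap, smul_inv_smul₀ (by positivity)]

theorem norm_energyMap_le (hP : SpectralResolution P) (h : X) : ‖hP.energyMap h‖ ≤ ‖h‖ := by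
  have := hP.norm_spectralMul_le abs_inv_sqrt_one_add_le_one h
  rwa [one_mul] at this

theorem energyMap_injective (hP : SpectralResolution P) {h k : X}
    (hk : hP.energyMap h = hP.energyMap k) : h = k :=
  hP.ext fun μ => by rw [← hP.sqrt_smul_proj_energyMap, hk, hP.sqrt_smul_proj_energyMap]

/-- Joint continuity gives measurability of `s ↦ e^{-(t-s)A} f(s)`. Clamping the time at 0 keeps the
multiplier bounded for all real times. -/
theorem continuous_spectralMul_exp_max (hP : SpectralResolution P) :
    Continuous fun z : ℝ × X => spectralMul P (fun μ => Real.exp (-μ * max z.1 0)) z.2 := by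
  refine continuous_prod_of_continuous_lipschitzWith' _ 1 (fun t => ?_) fun x => ?_
  · refine LipschitzWith.of_dist_le_mul fun x y => ?_
    have hm := abs_exp_neg_mul_le_one (le_max_right t 0)
    rw [dist_eq_norm, dist_eq_norm]
    have h := hP.norm_spectralMul_le hm (x - y)
    have e : spectralMul P (fun μ => Real.exp (-μ * max t 0)) (x - y) =
        spectralMul P (fun μ => Real.exp (-μ * max t 0)) x -
          spectralMul P (fun μ => Real.exp (-μ * max t 0)) y :=
      map_sub (hP.mulCLM _ 1 hm) x y
    rw [e] at h
    simpa using h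
  · rw [← continuousOn_univ]
    refine hP.continuousOn_tsum (g := fun μ => ‖P μ x‖ ^ 2)
      (a := fun t μ => Real.exp (-μ * max t 0) • P μ x)
      (fun t _ μ => hP.proj_smul_idem (fun μ => Real.exp (-μ * max t 0)) x μ)
      (fun μ => by fun_prop) (hP.summable_norm_sq x) fun t _ μ => ?_
    rcases lt_or_ge μ 0 with hμ | hμ
    · simp [hP.neg μ x hμ]
    · rw [norm_smul]
      exact pow_le_pow_left₀ (by positivity) (mul_le_of_le_one_left (norm_nonneg _)
        (abs_exp_neg_mul_le_one (le_max_right t 0) μ hμ)) 2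

theorem intervalIntegrable_spectralMul_exp (hP : SpectralResolution P) {f : ℝ → X} {t : ℝ}
    (hf : MemLp f 2 (volume.restrict (Ioc 0 t))) (ht : 0 ≤ t) :
    IntervalIntegrable (fun s => spectralMul P (fun μ => Real.exp (-μ * (t - s))) (f s))
      volume 0 t := by
  rw [intervalIntegrable_iff_integrableOn_Ioc_of_le ht]
  refine Integrable.mono (integrableOn_of_memLp_two hf) ?_ ?_
  · have h1 : AEStronglyMeasurable (fun s => ((t - s, f s) : ℝ × X)) (volume.restrict (Ioc 0 t)) :=
      (by fun_prop : Continuous fun s : ℝ => t - s).aestronglyMeasurable.prodMk hf.1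
    refine (hP.continuous_spectralMul_exp_max.comp_aestronglyMeasurable h1).congr ?_
    refine (ae_restrict_iff' measurableSet_Ioc).2 (Filter.Eventually.of_forall fun s hs => ?_)
    dsimp only
    rw [max_eq_left (sub_nonneg.2 hs.2)]
  · refine (ae_restrict_iff' measurableSet_Ioc).2 (Filter.Eventually.of_forall fun s hs => ?_)
    have h := hP.norm_spectralMul_le (abs_exp_neg_mul_le_one (sub_nonneg.2 hs.2)) (f s)
    rwa [one_mul] at h

theorem sqrt_smul_proj_integral (hP : SpectralResolution P) {f : ℝ → X} {t : ℝ}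
    (hf : MemLp f 2 (volume.restrict (Ioc 0 t))) (ht : 0 ≤ t) (μ : ℝ) :
    √(1 + μ) • P μ (∫ s in (0 : ℝ)..t, spectralMul P (fun μ => Real.exp (-μ * (t - s))) (f s)) =
      duhamelTerm P f t μ := by
  rw [← (P μ).intervalIntegral_comp_comm (hP.intervalIntegrable_spectralMul_exp hf ht), duhamelTerm]
  refine congrArg _ (intervalIntegral.integral_congr fun s hs => ?_)
  rw [uIcc_of_le ht] at hs
  exact hP.proj_spectralMul (abs_exp_neg_mul_le_one (sub_nonneg.2 hs.2)) (f s) μ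

end SpectralResolution

variable {A B : X →ₗ.[ℝ] X} {u : X} {lam : ℝ} {φ : X}

theorem powDomain_half (A : X →ₗ.[ℝ] X) :
    powDomain A (1 / 2) = {x | Summable fun μ : ℝ => μ * ‖eigenproj A μ x‖ ^ 2} := by
  simp [powDomain]

theorem fracPow_half (A : X →ₗ.[ℝ] X) (x : X) :
    fracPow A (1 / 2) x = spectralMul (eigenproj A) Real.sqrt x := by
  simp only [fracPow, spectralMul, Real.sqrt_eq_rpow]

theorem proj_fracPow (hP : SpectralResolution (eigenproj A)) (hu : u ∈ powDomain A (1 / 2))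
    (μ : ℝ) : eigenproj A μ (fracPow A (1 / 2) u) = √μ • eigenproj A μ u := by
  rw [fracPow_half]
  refine hP.proj_spectralMul_of_summable ?_ μ
  rw [powDomain_half] at hu
  refine hu.congr fun μ => ?_
  rcases lt_or_ge μ 0 with hμ | hμ
  · simp [hP.neg μ _ hμ]
  · rw [Real.sq_sqrt hμ]

theorem energyMap_mem_powDomain (hP : SpectralResolution (eigenproj A)) (h : X) :
    hP.energyMap h ∈ powDomain A (1 / 2) := by
  rw [powDomain_half]
  have key : ∀ μ, μ * ‖eigenproj A μ (hP.energyMap h)‖ ^ 2 =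
      ‖eigenproj A μ h‖ ^ 2 - ‖eigenproj A μ (hP.energyMap h)‖ ^ 2 := by
    intro μ
    rcases lt_or_ge μ 0 with hμ | hμ
    · simp [hP.neg μ _ hμ]
    · rw [← hP.sqrt_smul_proj_energyMap h μ, norm_smul, mul_pow, Real.norm_eq_abs, sq_abs,
        Real.sq_sqrt (by linarith)]
      ring
  refine Summable.congr ((hP.summable_norm_sq h).sub (hP.summable_norm_sq (hP.energyMap h)))
    fun μ => ?_
  exact (key μ).symm

theorem exists_energyMap_eq (hP : SpectralResolution (eigenproj A))
    (hu : u ∈ powDomain A (1 / 2)) : ∃ h, hP.energyMap h = u := by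
  rw [powDomain_half] at hu
  have hs : Summable fun μ => √(1 + μ) ^ 2 * ‖eigenproj A μ u‖ ^ 2 := by
    refine ((hP.summable_norm_sq u).add hu).congr fun μ => ?_
    rcases lt_or_ge μ 0 with hμ | hμ
    · simp [hP.neg μ _ hμ]
    · rw [Real.sq_sqrt (by linarith)]
      ring
  refine ⟨spectralMul (eigenproj A) (fun μ => √(1 + μ)) u, hP.ext fun μ => ?_⟩
  rw [hP.proj_energyMap, hP.proj_spectralMul_of_summable hs]
  rcases lt_or_ge μ 0 with hμ | hμ
  · simp [hP.neg μ _ hμ]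
  · rw [inv_smul_smul₀ (by positivity)]

/-- On the component `μ`, the weights `1` and `μ` of the two parts of the norm add up to `1 + μ`. -/
theorem powNorm_energyMap (hP : SpectralResolution (eigenproj A)) (h : X) :
    powNorm A (1 / 2) (hP.energyMap h) = ‖h‖ := by
  rw [powNorm, Real.sqrt_eq_iff_eq_sq (by positivity) (norm_nonneg _)]
  refine ((hP.hasSum_norm_sq _).add (hP.hasSum_norm_sq _)).unique
    ((hP.hasSum_norm_sq h).congr_fun fun μ => ?_)
  rw [proj_fracPow hP (energyMap_mem_powDomain hP h)]
  rcases lt_or_ge μ 0 with hμ | hμ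
  · simp [hP.neg μ _ hμ]
  · rw [← hP.sqrt_smul_proj_energyMap h μ, norm_smul, norm_smul, mul_pow, mul_pow,
      Real.norm_eq_abs, Real.norm_eq_abs, sq_abs, sq_abs, Real.sq_sqrt hμ,
      Real.sq_sqrt (by linarith)]
    ring

theorem continuous_fracPow_energyMap (hP : SpectralResolution (eigenproj A)) :
    Continuous fun h => fracPow A (1 / 2) (hP.energyMap h) := by
  have hm : ∀ μ : ℝ, 0 ≤ μ → |√μ * (√(1 + μ))⁻¹| ≤ 1 := fun μ hμ => by
    rw [abs_of_nonneg (by positivity), ← div_eq_mul_inv]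
    exact div_le_one_of_le₀ (Real.sqrt_le_sqrt (by linarith)) (Real.sqrt_nonneg _)
  refine (hP.mulCLM _ 1 hm).continuous.congr fun h => hP.ext fun μ => ?_
  rw [proj_fracPow hP (energyMap_mem_powDomain hP h), hP.proj_energyMap, hP.mulCLM_apply,
    hP.proj_spectralMul hm, smul_smul]

theorem energyMap_eigenvector (hP : SpectralResolution (eigenproj A)) (hlam : 0 ≤ lam)
    (hφ : eigenproj A lam φ = φ) : hP.energyMap (√(1 + lam) • φ) = φ := by
  refine hP.ext fun μ => ?_
  rw [hP.proj_energyMap, map_smul]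
  by_cases h : μ = lam
  · rw [h, inv_smul_smul₀ (by positivity)]
  · rw [← hφ, hP.ortho _ _ _ h, smul_zero, smul_zero]

theorem eigenvector_mem_powDomain (hP : SpectralResolution (eigenproj A)) (hlam : 0 ≤ lam)
    (hφ : eigenproj A lam φ = φ) : φ ∈ powDomain A (1 / 2) := by
  have h := energyMap_mem_powDomain hP (√(1 + lam) • φ)
  rwa [energyMap_eigenvector hP hlam hφ] at h

/-- The source of the amplitude mismatch: `φ` is normalized in `X`, not in `D(A^{1/2})`. -/
theorem powInner_eigenvector (hP : SpectralResolution (eigenproj A)) (hlam : 0 ≤ lam)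
    (hφ : eigenproj A lam φ = φ) (hu : u ∈ powDomain A (1 / 2)) :
    powInner A (1 / 2) u φ = (1 + lam) * inner ℝ u φ := by
  have h1 : fracPow A (1 / 2) φ = √lam • φ := by
    refine hP.ext fun μ => ?_
    rw [proj_fracPow hP (eigenvector_mem_powDomain hP hlam hφ), map_smul]
    by_cases h : μ = lam
    · rw [h]
    · rw [← hφ, hP.ortho _ _ _ h, smul_zero, smul_zero]
  have h2 : inner ℝ (fracPow A (1 / 2) u) φ = √lam * inner ℝ u φ := by
    conv_lhs => rw [← hφ, ← hP.symm, proj_fracPow hP hu, real_inner_smul_left, hP.symm, hφ]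
  rw [powInner, h1, real_inner_smul_right, h2, ← mul_assoc, Real.mul_self_sqrt hlam]
  ring

theorem exists_reduced_operator (hP : SpectralResolution (eigenproj A)) (hB : IsDominated A B) :
    ∃ G : X →L[ℝ] X, ∀ h, applyExt B (hP.energyMap h) = G h := by
  obtain ⟨C, -, hC⟩ := hB
  have hd : ∀ h, hP.energyMap h ∈ B.domain := fun h => (hC _ (energyMap_mem_powDomain hP h)).1
  refine ⟨LinearMap.mkContinuous
    { toFun := fun h => B ⟨hP.energyMap h, hd h⟩
      map_add' := fun x y => by
        rw [← B.map_add]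
        exact congrArg B (Subtype.ext (map_add _ x y))
      map_smul' := fun c x => by
        rw [RingHom.id_apply, ← B.map_smul]
        exact congrArg B (Subtype.ext (map_smul _ c x)) } C fun h => ?_, fun h => dif_pos (hd h)⟩
  obtain ⟨_, hle⟩ := hC _ (energyMap_mem_powDomain hP h)
  rwa [powNorm_energyMap] at hle

theorem CanSteer.isExactlyControllable (hP : SpectralResolution (eigenproj A)) {G : X →L[ℝ] X}
    (hG : ∀ h, applyExt B (hP.energyMap h) = G h) {T : ℝ} {h₀ h₁ : X}
    (H : CanSteer (eigenproj A) G T h₀ h₁) {ζ : ℝ → X} (hζ : hP.energyMap h₁ = ζ T) :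
    IsExactlyControllable A B T (hP.energyMap h₀) ζ := by
  obtain ⟨p, h, hp, hs, rfl⟩ := H
  refine ⟨p, hp, fun t => hP.energyMap (h t), ⟨fun t _ => energyMap_mem_powDomain hP _,
    hP.energyMap.continuous.comp_continuousOn hs.continuousOn,
    (continuous_fracPow_energyMap hP).comp_continuousOn hs.continuousOn, fun t ht => ?_⟩, hζ⟩
  simp only [hG]
  have hf := memLp_mono_Ioc (memLp_control_smul hp hs.continuousOn G) ht.2
  refine hP.ext fun μ => ?_
  rcases lt_or_ge μ 0 with hμ | hμ
  · rw [hP.neg μ _ hμ, hP.neg μ _ hμ]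
  have h1 : √(1 + μ) ≠ 0 := by positivity
  refine smul_right_injective X h1 ?_
  dsimp only
  rw [hP.sqrt_smul_proj_energyMap, hs.proj_eq t ht, map_sub, smul_sub]
  congr 1
  · change _ = √(1 + μ) • eigenproj A μ (spectralMul (eigenproj A)
      (fun μ => Real.exp (-μ * t)) (hP.energyMap h₀))
    rw [hP.proj_spectralMul (abs_exp_neg_mul_le_one ht.1), smul_comm, hP.sqrt_smul_proj_energyMap]
  · exact (hP.sqrt_smul_proj_integral hf ht.1 μ).symm

theorem integral_sq_le_of_eLpNorm_le {T C : ℝ} (hT : 0 ≤ T) (hC : 0 ≤ C) {q : ℝ → ℝ}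
    (hq : MemLp q 2 (volume.restrict (Ioc 0 T)))
    (h : eLpNorm q 2 (volume.restrict (Ioc 0 T)) ≤ ENNReal.ofReal C) :
    ∫ s in (0 : ℝ)..T, q s ^ 2 ≤ C ^ 2 := by
  rw [hq.eLpNorm_eq_integral_rpow_norm (by norm_num) (by norm_num), ENNReal.ofReal_le_ofReal_iff hC]
    at h
  simp only [ENNReal.toReal_ofNat, Real.rpow_two, Real.norm_eq_abs, sq_abs] at h
  rw [intervalIntegral.integral_of_le hT]
  have h0 : 0 ≤ ∫ s in Ioc 0 T, q s ^ 2 := integral_nonneg fun s => sq_nonneg _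
  have h2 := pow_le_pow_left₀ (by positivity) h 2
  rwa [← Real.rpow_natCast, ← Real.rpow_mul h0, Nat.cast_ofNat, inv_mul_cancel₀ (by norm_num),
    Real.rpow_one] at h2

/-- A null control for `(1 + A)^{-1/2} d` works after applying `(1 + A)^{1/2}` to the final state,
and `(1 + A)^{-1/2}` does not increase the norm. The factor 2 is there because the infimum in the
cost need not be attained. -/
theorem exists_reduced_null_control (hP : SpectralResolution (eigenproj A)) {G : X →L[ℝ] X}
    (hG : ∀ h, applyExt B (hP.energyMap h) = G h) (hlam : 0 ≤ lam)
    (hφ : eigenproj A lam φ = φ) {τ N : ℝ} (hτ : 0 < τ) (hN : 0 < N)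
    (hcost : controlCost A B φ τ ≤ ENNReal.ofReal N) (d : X) :
    ∃ q : ℝ → ℝ, MemLp q 2 (volume.restrict (Ioc 0 τ)) ∧
      ∫ s in (0 : ℝ)..τ, q s ^ 2 ≤ (2 * N * ‖d‖) ^ 2 ∧
      ∀ μ, Real.exp (-μ * τ) • eigenproj A μ d =
        duhamelTerm (eigenproj A) (fun s => q s • G (√(1 + lam) • φ)) τ μ := by
  by_cases hd : hP.energyMap d = 0
  · have : d = 0 := hP.energyMap_injective (by rw [hd, map_zero])
    subst this
    exact ⟨0, MemLp.zero, by simp, fun μ => by simp [duhamelTerm]⟩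
  set y : X := ‖hP.energyMap d‖⁻¹ • hP.energyMap d with hy
  have hn : 0 < ‖hP.energyMap d‖ := norm_pos_iff.2 hd
  have hy1 : ‖y‖ = 1 := by rw [hy, norm_smul, norm_inv, norm_norm, inv_mul_cancel₀ hn.ne']
  have h1 : (⨅ (p : ℝ → ℝ) (_ : IsControl τ p) (_ : linearSolution A B φ y p τ = 0),
      controlNorm τ p) < ENNReal.ofReal (2 * N) := by
    refine lt_of_le_of_lt (le_trans ?_ hcost)
      ((ENNReal.ofReal_lt_ofReal_iff (by positivity)).2 (by linarith))
    exact le_iSup₂ (f := fun (y₀ : X) (_ : ‖y₀‖ = 1) => ⨅ (p : ℝ → ℝ) (_ : IsControl τ p)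
      (_ : linearSolution A B φ y₀ p τ = 0), controlNorm τ p) y hy1
  simp only [iInf_lt_iff] at h1
  obtain ⟨p, hp, hlin, hpn⟩ := h1
  have hpI := integral_sq_le_of_eLpNorm_le hτ.le (by positivity) hp hpn.le
  refine ⟨fun s => ‖hP.energyMap d‖ * p s, hp.const_mul _, ?_, fun μ => ?_⟩
  · simp only [mul_pow]
    rw [intervalIntegral.integral_const_mul]
    calc ‖hP.energyMap d‖ ^ 2 * ∫ s in (0 : ℝ)..τ, p s ^ 2
        ≤ ‖d‖ ^ 2 * (2 * N) ^ 2 := by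
          refine mul_le_mul ?_ hpI
            (intervalIntegral.integral_nonneg hτ.le fun s _ => sq_nonneg _) (by positivity)
          exact pow_le_pow_left₀ hn.le (hP.norm_energyMap_le d) 2
      _ = _ := by ring
  · have hb : applyExt B φ = G (√(1 + lam) • φ) := by
      rw [← hG, energyMap_eigenvector hP hlam hφ]
    have hf := memLp_control_smul hp (continuousOn_const (c := √(1 + lam) • φ)) G
    have h2 : semigroup A τ y =
        ∫ s in (0 : ℝ)..τ, semigroup A (τ - s) (p s • G (√(1 + lam) • φ)) := by
      rw [linearSolution, hb] at hlin
      exact sub_eq_zero.1 hlin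
    have h3 : √(1 + μ) • eigenproj A μ (semigroup A τ y) =
        duhamelTerm (eigenproj A) (fun s => p s • G (√(1 + lam) • φ)) τ μ := by
      rw [h2]
      exact hP.sqrt_smul_proj_integral hf hτ.le μ
    have h4 : eigenproj A μ (semigroup A τ y) = Real.exp (-μ * τ) • eigenproj A μ y :=
      hP.proj_spectralMul (abs_exp_neg_mul_le_one hτ.le) y μ
    simp only [mul_smul]
    rw [duhamelTerm_smul, ← h3, h4, hy, map_smul, ← smul_comm (Real.exp _),
      ← smul_comm (Real.exp _)]
    congr 1
    rw [smul_comm (√(1 + μ)), hP.sqrt_smul_proj_energyMap, smul_inv_smul₀ hn.ne']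

end Energy

end BilinearControl

/-! ### Assembly -/

theorem mainTheorem3 {X : Type*} [NormedAddCommGroup X] [InnerProductSpace ℝ X] [CompleteSpace X]
    [TopologicalSpace.SeparableSpace X]
    (A B : X →ₗ.[ℝ] X) (lam₁ : ℝ) (φ₁ : X)
    (hA : IsAdmissible A)
    (hB : IsDominated A B)
    (hφ₁ : IsGroundState A lam₁ φ₁)
    (hnull : ∀ T : ℝ, 0 < T → IsNullControllable A B φ₁ T)
    (hcost : ∃ ν T₀ : ℝ, 0 < ν ∧ 0 < T₀ ∧ ∀ τ : ℝ, 0 < τ → τ ≤ T₀ →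
      controlCost A B φ₁ τ ≤ ENNReal.ofReal (Real.exp (ν / τ))) :
    ∀ R : ℝ, 0 < R → ∃ T_R : ℝ, 0 < T_R ∧
      ∀ u₀ ∈ powDomain A (1 / 2),
        powNorm A (1 / 2) (u₀ - powInner A (1 / 2) u₀ φ₁ • φ₁)
            ≤ R * |powInner A (1 / 2) u₀ φ₁| →
        IsExactlyControllable A B T_R u₀
          (fun t => powInner A (1 / 2) u₀ φ₁ • groundStateSolution lam₁ φ₁ t) := by
  intro R hR
  obtain ⟨ν, T₀, hν, hT₀, hcost⟩ := hcost
  obtain ⟨hnorm, hmem, hmin⟩ := hφ₁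
  have hP := hA.spectralResolution
  have hφ0 : φ₁ ≠ 0 := fun h => by simp [h] at hnorm
  have hlam : 0 ≤ lam₁ := hA.nonneg_of_mem_eigenspace hmem hφ0
  have hφ : eigenproj A lam₁ φ₁ = φ₁ := eigenproj_eq_self hmem
  obtain ⟨G, hG⟩ := exists_reduced_operator hP hB
  set e : X := √(1 + lam₁) • φ₁ with he_def
  have hsqrt : √(1 + lam₁) ≠ 0 := by positivity
  have he : eigenproj A lam₁ e = e := by rw [he_def, map_smul, hφ]
  have he0 : e ≠ 0 := smul_ne_zero hsqrt hφ0
  have hJe : hP.energyMap e = φ₁ := energyMap_eigenvector hP hlam hφ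
  have hctrl := fun τ (hτ : 0 < τ) (hτT : τ ≤ T₀) =>
    exists_reduced_null_control hP hG hlam hφ hτ (Real.exp_pos (ν / τ)) (hcost τ hτ hτT)
  obtain ⟨g, hg, hgap⟩ := hA.exists_spectral_gap lam₁
  have hgap' : ∀ μ x, μ ≠ lam₁ → μ < lam₁ + g → eigenproj A μ x = 0 := by
    intro μ x hμ hμg
    refine eigenproj_eq_zero ?_ x
    rcases lt_or_gt_of_ne hμ with h | h
    · by_contra hne
      exact absurd (hmin μ hne) (not_le.2 h)
    · exact hgap μ h hμg
  obtain ⟨δ, T, hδ, hT, hloc⟩ := exists_local_controllability (G := G) hP hlam he hν hT₀ hctrl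
  obtain ⟨T', hT', hglob⟩ := exists_canSteer_ground hP hlam he hg hgap' hδ hT hloc hR
  refine ⟨T', hT', fun u₀ hu₀ hle => ?_⟩
  obtain ⟨h₀, rfl⟩ := exists_energyMap_eq hP hu₀
  set α : ℝ := powInner A (1 / 2) (hP.energyMap h₀) φ₁ with hα
  have hle' : ‖h₀ - α • e‖ ≤ R * |α| := by
    rw [← powNorm_energyMap hP, map_sub, map_smul, hJe]
    exact hle
  refine CanSteer.isExactlyControllable hP hG (h₁ := α • Real.exp (-lam₁ * T') • e) ?_ ?_
  swap
  · rw [map_smul, map_smul, hJe, groundStateSolution]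
  by_cases hα0 : α = 0
  · have h0 : h₀ = 0 := by simpa [hα0] using hle'
    have h1 := canSteer_free (G := G) hP T' h₀
    rw [hα0, zero_smul]
    simpa [h0, spectralMul] using h1
  · have h1 : ‖α⁻¹ • h₀ - e‖ ≤ R := by
      have : α⁻¹ • h₀ - e = α⁻¹ • (h₀ - α • e) := by rw [smul_sub, inv_smul_smul₀ hα0]
      rw [this, norm_smul, norm_inv, Real.norm_eq_abs, inv_mul_le_iff₀ (abs_pos.2 hα0), mul_comm]
      exact hle'
    -- By simplicity the projection is `c • e` with `c = ⟨u₀, φ₁⟩`, while `α = (1 + lam₁) c`;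
    -- normalizing `α` to 1 leaves `(1 + lam₁)⁻¹`.
    have h2 : eigenproj A lam₁ (α⁻¹ • h₀) = (1 + lam₁)⁻¹ • e := by
      obtain ⟨c, hc⟩ := exists_proj_eq_smul he he0 (τ := T₀) (G := G)
        (fun d => (hctrl T₀ hT₀ le_rfl d).imp fun q hq => ⟨hq.1, hq.2.2⟩) h₀
      have h3 : inner ℝ (hP.energyMap h₀) φ₁ = c := by
        conv_lhs => rw [← hφ]
        rw [← hP.symm, hP.proj_energyMap, hc, he_def, smul_comm c, inv_smul_smul₀ hsqrt,
          real_inner_smul_left, real_inner_self_eq_norm_sq, hnorm, one_pow, mul_one]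
      have h4 : α = (1 + lam₁) * c := by
        rw [hα, powInner_eigenvector hP hlam hφ hu₀, h3]
      have hc0 : c ≠ 0 := fun h => hα0 (by rw [h4, h, mul_zero])
      rw [map_smul, hc, smul_smul, h4]
      congr 1
      field_simp
    have h3 := (hglob (α⁻¹ • h₀) h1 h2).smul α
    rwa [smul_inv_smul₀ hα0] at h3
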